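/- Let $\Bbbk$ be a field with $\operatorname{char}\Bbbk\neq 2$ and $n\ge 0$. Let $E(n)$ be the Hopf algebra over $\Bbbk$ generated by $g,x_1,\dots,x_n$ with $g^2=1$, $x_i^2=0$, $gx_i=-x_ig$, $x_ix_j=-x_jx_i$ ($i<j$), $\Delta(g)=g\otimes g$, $\Delta(x_i)=x_i\otimes g+1\otimes x_i$, $\varepsilon(g)=1$, $\varepsilon(x_i)=0$, $S(g)=g$, $S(x_i)=gx_i$. For scalars $\alpha,\beta_i,\gamma_i$ ($1\le i\le n$) and $\lambda_{ij}$ ($1\le i<j\le n$), let $A=Cl(\alpha,\beta_i,\gamma_i,\lambda_{ij})$ be the unital associative algebra generated by $G,X_1,\dots,X_n$ with $G^2=\alpha$, $X_i^2=\beta_i$, $GX_i+X_iG=\gamma_i$, $X_iX_j+X_jX_i=\lambda_{ij}$ ($i<j$), with its canonical $E(n)$-comodule algebra structure $\rho(G)=G\otimes g$, $\rho(X_i)=X_i\otimes g+1\otimes x_i$. Put $H=E(n)$. For $P=\{i_1<\dots<i_s\}\subseteq\{1,\dots,n\}$ write $x_P=x_{i_1}\cdots x_{i_s}$, $X_P=X_{i_1}\cdots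 X_{i_s}$, and for $F=\{i_{j_1},\dots,i_{j_r}\}\subseteq P$ put $S(F,P)=j_1+\cdots+j_r-\frac{r(r+1)}2$. The cowreath $(A\otimes H^{op},H,\psi)$, $\psi(h\otimes a\otimes l)=a_0\otimes l_1\otimes l_2ha_1$, is called rth-separable (right-trivially h-separable) if there is a linear map $B^A:H\otimes H\to A$, called here a Casimir element, such that for all $a\in A$ and $h,h',h''\in H$ $$a_0B^A(ha_1\otimes h'a_2)=B^A(h\otimes h')a,\qquad \rho(B^A(1\otimes h))=B^A(1\otimes h_1)\otimes h_2,$$ $$B^A(h_1h'\otimes h_2h'')=\varepsilon(h)B^A(h'\otimes h''),\qquad B^A(1\otimes 1)=1,$$ $$B^A(h\otimes 1)B^A(1\otimes h')=B^A(h\otimes h').$$ **Theorem.** The cowreath $(A\otimes H^{op},H,\psi)$ is rth-separable if and only if $\alpha\ne0$ and there is $\mu\in\Bbbk$ with $\mu^2\alpha=1$, and $$\beta_i=\frac{\gamma_i^2}{4\alpha}\ \ (1\le i\le n),\qquad \lambda_{ij}=\frac{\gamma_i\gamma_j}{2\alpha}\ \ (1\le i<j\le n).$$ Moreover, a linear map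 $B^A:H\otimes H\to A$ is a Casimir element as above if and only if these conditions on the scalars hold and, for some $\mu\in\Bbbk$ with $\mu^2\alpha=1$, for all $j,k\in\{0,1\}$ and $P,Q\subseteq\{1,\dots,n\}$, $$B^A(g^jx_P\otimes g^kx_Q)=B^A(1\otimes S(g^jx_P)g^kx_Q),$$ $$B^A(1\otimes x_Q)=\sum_{\substack{R\subseteq Q\\ |R|\equiv|Q|\,(2)}}(-1)^{S(Q\setminus R,Q)+\frac{|Q|-|R|}2}\frac{\prod_{j\in Q\setminus R}\gamma_j}{2^{|Q|-|R|}\alpha^{\frac{|Q|-|R|}2}}X_R+\sum_{\substack{R\subseteq Q\\ |R|\not\equiv|Q|\,(2)}}(-1)^{S(Q\setminus R,Q)+\frac{|Q|-|R|+1}2}\frac{\prod_{j\in Q\setminus R}\gamma_j}{2^{|Q|-|R|}\alpha^{\frac{|Q|-|R|+1}2}}GX_R,$$ $$B^A(1\otimes gx_Q)=(\mu G)\,B^A(1\otimes x_Q);$$ and for every $\mu\in\Bbbk$ with $\mu^2\alpha=1$ these three formulas define exactly one linear map $B^A$. -/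

import Mathlib

open scoped TensorProduct

namespace CliffordCowreath

noncomputable section

/-! ### The Clifford algebras `Cl(α, β_i, γ_i, λ_ij)` -/

/-- The defining relations of `Cl(α, β_i, γ_i, λ_ij)` on the free algebra with generators
`G` (the letter `none`) and `X_i` (the letter `some i`). Only the scalars `lam i j` with `i < j`
are used. -/
inductive ClRel {k : Type*} [Field k] {n : ℕ} (α : k) (β γ : Fin n → k) (lam : Fin n → Fin n → k) :
    FreeAlgebra k (Option (Fin n)) → FreeAlgebra k (Option (Fin n)) → Prop
  | G_sq : ClRel α β γ lam
      (FreeAlgebra.ι k none * FreeAlgebra.ι k none) (algebraMap k _ α)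
  | X_sq (i : Fin n) : ClRel α β γ lam
      (FreeAlgebra.ι k (some i) * FreeAlgebra.ι k (some i)) (algebraMap k _ (β i))
  | G_X (i : Fin n) : ClRel α β γ lam
      (FreeAlgebra.ι k none * FreeAlgebra.ι k (some i)
        + FreeAlgebra.ι k (some i) * FreeAlgebra.ι k none) (algebraMap k _ (γ i))
  | X_X (i j : Fin n) (hij : i < j) : ClRel α β γ lam
      (FreeAlgebra.ι k (some i) * FreeAlgebra.ι k (some j)
        + FreeAlgebra.ι k (some j) * FreeAlgebra.ι k (some i)) (algebraMap k _ (lam i j))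

/-- The unital associative algebra `Cl(α, β_i, γ_i, λ_ij)` generated by `G, X_1, …, X_n` with
`G² = α`, `X_i² = β_i`, `G X_i + X_i G = γ_i` and `X_i X_j + X_j X_i = λ_ij` for `i < j`. -/
def Cl {k : Type*} [Field k] {n : ℕ} (α : k) (β γ : Fin n → k) (lam : Fin n → Fin n → k) : Type _ :=
  RingQuot (ClRel α β γ lam)

namespace Cl

variable {k : Type*} [Field k] {n : ℕ} (α : k) (β γ : Fin n → k) (lam : Fin n → Fin n → k)

instance : Ring (Cl α β γ lam) := inferInstanceAs (Ring (RingQuot (ClRel α β γ lam)))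

instance : Algebra k (Cl α β γ lam) :=
  inferInstanceAs (Algebra k (RingQuot (ClRel α β γ lam)))

/-- The quotient map from the free algebra. -/
def mk : FreeAlgebra k (Option (Fin n)) →ₐ[k] Cl α β γ lam :=
  RingQuot.mkAlgHom k (ClRel α β γ lam)

/-- The generator `G`. -/
def G : Cl α β γ lam := mk α β γ lam (FreeAlgebra.ι k none)

/-- The generators `X_i`. -/
def X (i : Fin n) : Cl α β γ lam := mk α β γ lam (FreeAlgebra.ι k (some i))

theorem G_mul_G : G α β γ lam * G α β γ lam = algebraMap k _ α := by
  have h := RingQuot.mkAlgHom_rel k (ClRel.G_sq (α := α) (β := β) (γ := γ) (lam := lam))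
  rw [map_mul, AlgHom.commutes] at h
  exact h

theorem X_mul_X (i : Fin n) : X α β γ lam i * X α β γ lam i = algebraMap k _ (β i) := by
  have h := RingQuot.mkAlgHom_rel k (ClRel.X_sq (α := α) (β := β) (γ := γ) (lam := lam) i)
  rw [map_mul, AlgHom.commutes] at h
  exact h

theorem G_mul_X_add (i : Fin n) : G α β γ lam * X α β γ lam i + X α β γ lam i * G α β γ lam
    = algebraMap k _ (γ i) := by
  have h := RingQuot.mkAlgHom_rel k (ClRel.G_X (α := α) (β := β) (γ := γ) (lam := lam) i)
  rw [map_add, map_mul, map_mul, AlgHom.commutes] at h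
  exact h

theorem X_mul_X_add (i j : Fin n) (hij : i < j) :
    X α β γ lam i * X α β γ lam j + X α β γ lam j * X α β γ lam i = algebraMap k _ (lam i j) := by
  have h := RingQuot.mkAlgHom_rel k (ClRel.X_X (α := α) (β := β) (γ := γ) (lam := lam) i j hij)
  rw [map_add, map_mul, map_mul, AlgHom.commutes] at h
  exact h

variable {α β γ lam}

/-- The universal property of `Cl(α, β_i, γ_i, λ_ij)`. -/
def lift {B : Type*} [Ring B] [Algebra k B] (a : B) (b : Fin n → B)
    (haa : a * a = algebraMap k B α) (hbb : ∀ i, b i * b i = algebraMap k B (β i))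
    (hab : ∀ i, a * b i + b i * a = algebraMap k B (γ i))
    (hbc : ∀ i j, i < j → b i * b j + b j * b i = algebraMap k B (lam i j)) :
    Cl α β γ lam →ₐ[k] B :=
  RingQuot.liftAlgHom k ⟨FreeAlgebra.lift k (fun o : Option (Fin n) => o.elim a b), by
    intro u v huv
    cases huv with
    | G_sq => simpa using haa
    | X_sq i => simpa using hbb i
    | G_X i => simpa using hab i
    | X_X i j hij => simpa using hbc i j hij⟩

section

variable {B : Type*} [Ring B] [Algebra k B] (a : B) (b : Fin n → B)
    (haa : a * a = algebraMap k B α) (hbb : ∀ i, b i * b i = algebraMap k B (β i))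
    (hab : ∀ i, a * b i + b i * a = algebraMap k B (γ i))
    (hbc : ∀ i j, i < j → b i * b j + b j * b i = algebraMap k B (lam i j))

theorem lift_G : lift a b haa hbb hab hbc (G α β γ lam) = a := by
  unfold lift G mk
  erw [RingQuot.liftAlgHom_mkAlgHom_apply]
  simp

theorem lift_X (i : Fin n) : lift a b haa hbb hab hbc (X α β γ lam i) = b i := by
  unfold lift X mk
  erw [RingQuot.liftAlgHom_mkAlgHom_apply]
  simp

end

theorem algHom_ext {B : Type*} [Semiring B] [Algebra k B] {f f' : Cl α β γ lam →ₐ[k] B}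
    (hG : f (G α β γ lam) = f' (G α β γ lam))
    (hX : ∀ i, f (X α β γ lam i) = f' (X α β γ lam i)) : f = f' := by
  have h : f.comp (mk α β γ lam) = f'.comp (mk α β γ lam) := by
    apply FreeAlgebra.hom_ext
    funext o
    cases o with
    | none => exact hG
    | some i => exact hX i
  exact RingQuot.ringQuot_ext' k f f' h

end Cl

/-! ### The Hopf algebras `E(n)` -/

/-- The defining relations of `E(n)` on the free algebra with generators `g` (the letter `none`)
and `x_i` (the letter `some i`). -/
inductive ERel (k : Type*) [Field k] (n : ℕ) :
    FreeAlgebra k (Option (Fin n)) → FreeAlgebra k (Option (Fin n)) → Prop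
  | g_sq : ERel k n (FreeAlgebra.ι k none * FreeAlgebra.ι k none) 1
  | x_sq (i : Fin n) : ERel k n (FreeAlgebra.ι k (some i) * FreeAlgebra.ι k (some i)) 0
  | g_x (i : Fin n) : ERel k n (FreeAlgebra.ι k none * FreeAlgebra.ι k (some i))
      (-(FreeAlgebra.ι k (some i) * FreeAlgebra.ι k none))
  | x_x (i j : Fin n) (hij : i < j) :
      ERel k n (FreeAlgebra.ι k (some i) * FreeAlgebra.ι k (some j))
        (-(FreeAlgebra.ι k (some j) * FreeAlgebra.ι k (some i)))

/-- The algebra `E(n)` generated by `g, x_1, …, x_n` with `g² = 1`, `x_i² = 0`, `g x_i = - x_i g`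
and `x_i x_j = - x_j x_i` for `i < j`. -/
def E (k : Type*) [Field k] (n : ℕ) : Type _ := RingQuot (ERel k n)

namespace E

variable (k : Type*) [Field k] (n : ℕ)

instance : Ring (E k n) := inferInstanceAs (Ring (RingQuot (ERel k n)))

instance : Algebra k (E k n) := inferInstanceAs (Algebra k (RingQuot (ERel k n)))

/-- The quotient map from the free algebra. -/
def mk : FreeAlgebra k (Option (Fin n)) →ₐ[k] E k n := RingQuot.mkAlgHom k (ERel k n)

/-- The generator `g`. -/
def g : E k n := mk k n (FreeAlgebra.ι k none)

variable {n} in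
/-- The generators `x_i`. -/
def x (i : Fin n) : E k n := mk k n (FreeAlgebra.ι k (some i))

theorem g_mul_g : g k n * g k n = 1 := by
  have h := RingQuot.mkAlgHom_rel k (ERel.g_sq (k := k) (n := n))
  rw [map_mul, map_one] at h
  exact h

variable {n}

theorem x_mul_x (i : Fin n) : x k i * x k i = 0 := by
  have h := RingQuot.mkAlgHom_rel k (ERel.x_sq (k := k) i)
  rw [map_mul, map_zero] at h
  exact h

theorem g_mul_x (i : Fin n) : g k n * x k i = -(x k i * g k n) := by
  have h := RingQuot.mkAlgHom_rel k (ERel.g_x (k := k) i)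
  rw [map_neg, map_mul, map_mul] at h
  exact h

theorem x_mul_x_of_lt (i j : Fin n) (hij : i < j) : x k i * x k j = -(x k j * x k i) := by
  have h := RingQuot.mkAlgHom_rel k (ERel.x_x (k := k) i j hij)
  rw [map_neg, map_mul, map_mul] at h
  exact h

variable {k}

/-- The universal property of `E(n)`. -/
def lift {B : Type*} [Ring B] [Algebra k B] (a : B) (b : Fin n → B)
    (haa : a * a = 1) (hbb : ∀ i, b i * b i = 0) (hab : ∀ i, a * b i = -(b i * a))
    (hbc : ∀ i j, i < j → b i * b j = -(b j * b i)) : E k n →ₐ[k] B :=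
  RingQuot.liftAlgHom k ⟨FreeAlgebra.lift k (fun o : Option (Fin n) => o.elim a b), by
    intro u v huv
    cases huv with
    | g_sq => simpa using haa
    | x_sq i => simpa using hbb i
    | g_x i => simpa using hab i
    | x_x i j hij => simpa using hbc i j hij⟩

section

variable {B : Type*} [Ring B] [Algebra k B] (a : B) (b : Fin n → B)
    (haa : a * a = 1) (hbb : ∀ i, b i * b i = 0) (hab : ∀ i, a * b i = -(b i * a))
    (hbc : ∀ i j, i < j → b i * b j = -(b j * b i))

theorem lift_g : lift a b haa hbb hab hbc (g k n) = a := by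
  unfold lift g mk
  erw [RingQuot.liftAlgHom_mkAlgHom_apply]
  simp

theorem lift_x (i : Fin n) : lift a b haa hbb hab hbc (x k i) = b i := by
  unfold lift x mk
  erw [RingQuot.liftAlgHom_mkAlgHom_apply]
  simp

end

theorem algHom_ext {B : Type*} [Semiring B] [Algebra k B] {f f' : E k n →ₐ[k] B}
    (hg : f (g k n) = f' (g k n)) (hx : ∀ i, f (x k i) = f' (x k i)) : f = f' := by
  have h : f.comp (mk k n) = f'.comp (mk k n) := by
    apply FreeAlgebra.hom_ext
    funext o
    cases o with
    | none => exact hg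
    | some i => exact hx i
  exact RingQuot.ringQuot_ext' k f f' h

theorem induction {p : E k n → Prop} (hc : ∀ c : k, p (algebraMap k _ c)) (hg : p (g k n))
    (hx : ∀ i, p (x k i)) (hmul : ∀ a b, p a → p b → p (a * b))
    (hadd : ∀ a b, p a → p b → p (a + b)) (h : E k n) : p h := by
  obtain ⟨u, rfl⟩ : ∃ u, mk k n u = h := RingQuot.mkAlgHom_surjective k (ERel k n) h
  induction u using FreeAlgebra.induction with
  | grade0 c => rw [AlgHom.commutes]; exact hc c
  | grade1 o =>
    cases o with
    | none => exact hg
    | some i => exact hx i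
  | mul a b ha hb => rw [map_mul]; exact hmul _ _ ha hb
  | add a b ha hb => rw [map_add]; exact hadd _ _ ha hb

variable (k n)

/-- The comultiplication: `Δ(g) = g ⊗ g`, `Δ(x_i) = x_i ⊗ g + 1 ⊗ x_i`. -/
def comulHom : E k n →ₐ[k] E k n ⊗[k] E k n :=
  lift (g k n ⊗ₜ g k n) (fun i => x k i ⊗ₜ g k n + 1 ⊗ₜ x k i)
    (by simp [g_mul_g, Algebra.TensorProduct.one_def])
    (fun i => by
      simp only [mul_add, add_mul, Algebra.TensorProduct.tmul_mul_tmul, x_mul_x, g_mul_x, mul_one,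
        one_mul, TensorProduct.zero_tmul, TensorProduct.tmul_zero, TensorProduct.tmul_neg]
      abel)
    (fun i => by
      simp only [mul_add, add_mul, Algebra.TensorProduct.tmul_mul_tmul, g_mul_x, mul_one, one_mul,
        TensorProduct.tmul_neg, TensorProduct.neg_tmul]
      abel)
    (fun i j hij => by
      simp only [mul_add, add_mul, Algebra.TensorProduct.tmul_mul_tmul, x_mul_x_of_lt k i j hij,
        g_mul_x, mul_one, one_mul, TensorProduct.tmul_neg, TensorProduct.neg_tmul]
      abel)

/-- The counit: `ε(g) = 1`, `ε(x_i) = 0`. -/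
def counitHom : E k n →ₐ[k] k :=
  lift 1 (fun _ => 0) (by simp) (by simp) (by simp) (by simp)

open MulOpposite in
/-- The antipode as an algebra map into the opposite algebra: `S(g) = g`, `S(x_i) = g x_i`. -/
def antipodeHom : E k n →ₐ[k] (E k n)ᵐᵒᵖ :=
  lift (op (g k n)) (fun i => op (g k n * x k i))
    (by rw [← op_mul, g_mul_g, op_one])
    (fun i => by
      rw [← op_mul, g_mul_x, neg_mul_neg, mul_assoc, ← mul_assoc (g k n), g_mul_x, neg_mul,
        mul_neg, mul_assoc, ← mul_assoc, x_mul_x, zero_mul, neg_zero, op_zero])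
    (fun i => by
      rw [← op_mul, ← op_mul, ← op_neg]
      congr 1
      rw [← mul_assoc, mul_assoc (g k n) (x k i), ← neg_eq_iff_eq_neg.mpr (g_mul_x k i), mul_neg,
        ← mul_assoc])
    (fun i j hij => by
      have h : ∀ a b : Fin n, g k n * x k a * (g k n * x k b) = -(x k a * x k b) := by
        intro a b
        rw [g_mul_x, neg_mul, mul_assoc, ← mul_assoc (g k n), g_mul_g, one_mul]
      rw [← op_mul, ← op_mul, ← op_neg, h, h, x_mul_x_of_lt k i j hij, neg_neg])

theorem comulHom_g : comulHom k n (g k n) = g k n ⊗ₜ g k n := lift_g ..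

variable {n} in
theorem comulHom_x (i : Fin n) : comulHom k n (x k i) = x k i ⊗ₜ g k n + 1 ⊗ₜ x k i := lift_x ..

theorem counitHom_g : counitHom k n (g k n) = 1 := lift_g ..

variable {n} in
theorem counitHom_x (i : Fin n) : counitHom k n (x k i) = 0 := lift_x ..

theorem antipodeHom_g : antipodeHom k n (g k n) = MulOpposite.op (g k n) := lift_g ..

variable {n} in
theorem antipodeHom_x (i : Fin n) : antipodeHom k n (x k i) = MulOpposite.op (g k n * x k i) :=
  lift_x ..

instance : Bialgebra k (E k n) :=
  Bialgebra.ofAlgHom (comulHom k n) (counitHom k n)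
    (by
      apply algHom_ext
      · simp [comulHom_g]
      · intro i
        simp [comulHom_x, comulHom_g, TensorProduct.add_tmul, TensorProduct.tmul_add,
          Algebra.TensorProduct.one_def, add_assoc])
    (by
      apply algHom_ext
      · simp [comulHom_g, counitHom_g]
      · intro i
        simp [comulHom_x, counitHom_x])
    (by
      apply algHom_ext
      · simp [comulHom_g, counitHom_g]
      · intro i
        simp [comulHom_x, counitHom_x, counitHom_g])

/-- The antipode of `E(n)` as a linear map. -/
def antipodeLinear : E k n →ₗ[k] E k n :=
  (MulOpposite.opLinearEquiv k).symm.toLinearMap ∘ₗ (antipodeHom k n).toLinearMap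

theorem antipodeLinear_mul (a b : E k n) :
    antipodeLinear k n (a * b) = antipodeLinear k n b * antipodeLinear k n a := by
  simp [antipodeLinear]

theorem antipodeLinear_algebraMap (c : k) :
    antipodeLinear k n (algebraMap k _ c) = algebraMap k _ c := by
  simp [antipodeLinear]

theorem antipodeLinear_one : antipodeLinear k n 1 = 1 := by
  simp [antipodeLinear]

theorem antipodeLinear_g : antipodeLinear k n (g k n) = g k n := by
  simp [antipodeLinear, antipodeHom_g]

variable {n} in
theorem antipodeLinear_x (i : Fin n) : antipodeLinear k n (x k i) = g k n * x k i := by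
  simp [antipodeLinear, antipodeHom_x]

theorem mul_antipode_left (h : E k n) :
    LinearMap.mul' k (E k n) ((antipodeLinear k n).rTensor (E k n) (comulHom k n h))
      = algebraMap k (E k n) (counitHom k n h) := by
  have key : ∀ (s t : E k n ⊗[k] E k n) (c : k),
      LinearMap.mul' k (E k n) ((antipodeLinear k n).rTensor (E k n) t) = algebraMap k _ c →
      LinearMap.mul' k (E k n) ((antipodeLinear k n).rTensor (E k n) (t * s))
        = algebraMap k _ c * LinearMap.mul' k (E k n) ((antipodeLinear k n).rTensor (E k n) s) := by
    intro s t c ht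
    induction s using TensorProduct.induction_on with
    | zero => simp
    | add s₁ s₂ h₁ h₂ => simp only [mul_add, map_add, h₁, h₂]
    | tmul u v =>
      have : ∀ t : E k n ⊗[k] E k n,
          LinearMap.mul' k (E k n) ((antipodeLinear k n).rTensor (E k n) (t * (u ⊗ₜ v)))
            = antipodeLinear k n u
              * LinearMap.mul' k (E k n) ((antipodeLinear k n).rTensor (E k n) t) * v := by
        intro t
        induction t using TensorProduct.induction_on with
        | zero => simp
        | add t₁ t₂ h₁ h₂ => simp only [mul_add, add_mul, map_add, h₁, h₂]
        | tmul a b => simp [antipodeLinear_mul, mul_assoc]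
      rw [this, ht, ← Algebra.commutes]
      simp [mul_assoc]
  induction h using induction with
  | hc c => simp [Algebra.TensorProduct.algebraMap_apply, antipodeLinear_algebraMap]
  | hg => simp [comulHom_g, counitHom_g, antipodeLinear_g, g_mul_g]
  | hx i =>
    simp [comulHom_x, counitHom_x, antipodeLinear_x, antipodeLinear_one, g_mul_x, mul_assoc,
      g_mul_g]
  | hmul a b ha hb => rw [map_mul, key _ _ _ ha, hb, map_mul, map_mul]
  | hadd a b ha hb => simp only [map_add, ha, hb]

theorem mul_antipode_right (h : E k n) :
    LinearMap.mul' k (E k n) ((antipodeLinear k n).lTensor (E k n) (comulHom k n h))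
      = algebraMap k (E k n) (counitHom k n h) := by
  have key : ∀ (t s : E k n ⊗[k] E k n) (c : k),
      LinearMap.mul' k (E k n) ((antipodeLinear k n).lTensor (E k n) s) = algebraMap k _ c →
      LinearMap.mul' k (E k n) ((antipodeLinear k n).lTensor (E k n) (t * s))
        = LinearMap.mul' k (E k n) ((antipodeLinear k n).lTensor (E k n) t) * algebraMap k _ c := by
    intro t s c hs
    induction t using TensorProduct.induction_on with
    | zero => simp
    | add t₁ t₂ h₁ h₂ => simp only [add_mul, map_add, h₁, h₂]
    | tmul u v =>
      have : ∀ s : E k n ⊗[k] E k n,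
          LinearMap.mul' k (E k n) ((antipodeLinear k n).lTensor (E k n) ((u ⊗ₜ v) * s))
            = u * LinearMap.mul' k (E k n) ((antipodeLinear k n).lTensor (E k n) s)
              * antipodeLinear k n v := by
        intro s
        induction s using TensorProduct.induction_on with
        | zero => simp
        | add s₁ s₂ h₁ h₂ => simp only [mul_add, add_mul, map_add, h₁, h₂]
        | tmul a b => simp [antipodeLinear_mul, mul_assoc]
      rw [this, hs, mul_assoc, Algebra.commutes]
      simp [mul_assoc]
  induction h using induction with
  | hc c => simp [Algebra.TensorProduct.algebraMap_apply, antipodeLinear_one]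
  | hg => simp [comulHom_g, counitHom_g, antipodeLinear_g, g_mul_g]
  | hx i => simp [comulHom_x, counitHom_x, antipodeLinear_x, antipodeLinear_g, g_mul_x]
  | hmul a b ha hb => rw [map_mul, key _ _ _ hb, ha, map_mul, map_mul]
  | hadd a b ha hb => simp only [map_add, ha, hb]

instance : HopfAlgebra k (E k n) where
  antipode := antipodeLinear k n
  mul_antipode_rTensor_comul := LinearMap.ext (mul_antipode_left k n)
  mul_antipode_lTensor_comul := LinearMap.ext (mul_antipode_right k n)

end E

/-! ### Comodule algebras and right-trivial h-separability -/

/-- A right `H`-comodule algebra structure on the algebra `A`: a coassociative and counital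
coaction `ρ : A → A ⊗ H` that is a morphism of algebras. -/
structure RightComoduleAlgebra (k H A : Type*) [Field k] [Ring H] [HopfAlgebra k H]
    [Ring A] [Algebra k A] where
  /-- The coaction `ρ`. -/
  coact : A →ₐ[k] A ⊗[k] H
  coassoc : ∀ a, TensorProduct.assoc k A H H (coact.toLinearMap.rTensor H (coact a))
    = (Coalgebra.comul (R := k) (A := H)).lTensor A (coact a)
  counit : ∀ a, TensorProduct.rid k A ((Coalgebra.counit (R := k) (A := H)).lTensor A (coact a)) = a

/-- `IsRthCasimir ρ B` says that the linear map `B = B^A : H ⊗ H → A` is a Casimir element of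
right-trivial form realizing the h-separability of the cowreath `(A ⊗ H^op, H, ψ)`, that is, the
Casimir morphism is `h ⊗ h' ↦ B^A(h ⊗ h') ⊗ 1_H`. Here `H` has a bijective antipode. -/
structure IsRthCasimir {k H A : Type*} [Field k] [Ring H] [HopfAlgebra k H]
    [Ring A] [Algebra k A] (ρ : RightComoduleAlgebra k H A) (B : H ⊗[k] H →ₗ[k] A) : Prop where
  /-- `a₀ B(h a₁ ⊗ h' a₂) = B(h ⊗ h') a`. -/
  casimir_bimodule : ∀ (a : A) (h h' : H),
    LinearMap.mul' k A
      ((B ∘ₗ LinearMap.mulLeft k (h ⊗ₜ[k] h')).lTensor A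
        ((Coalgebra.comul (R := k) (A := H)).lTensor A (ρ.coact a)))
      = B (h ⊗ₜ h') * a
  /-- `ρ(B(1 ⊗ h)) = B(1 ⊗ h₁) ⊗ h₂`. -/
  casimir_colinear : ∀ h : H,
    ρ.coact (B (1 ⊗ₜ h))
      = (B ∘ₗ TensorProduct.mk k H H 1).rTensor H (Coalgebra.comul (R := k) h)
  /-- `B(h₁ h' ⊗ h₂ h'') = ε(h) B(h' ⊗ h'')`. -/
  casimir_balanced : ∀ h h' h'' : H,
    B (Coalgebra.comul (R := k) h * (h' ⊗ₜ h'')) = Coalgebra.counit (R := k) h • B (h' ⊗ₜ h'')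
  /-- `B(1 ⊗ 1) = 1`. -/
  normalized : B (1 ⊗ₜ 1) = 1
  /-- `B(h ⊗ 1) B(1 ⊗ h') = B(h ⊗ h')`. -/
  heavy : ∀ h h' : H, B (h ⊗ₜ 1) * B (1 ⊗ₜ h') = B (h ⊗ₜ h')

/-- The cowreath `(A ⊗ H^op, H, ψ)` attached to the `H`-comodule algebra `(A, ρ)` is right-trivially
h-separable. -/
def RthSeparable {k H A : Type*} [Field k] [Ring H] [HopfAlgebra k H]
    [Ring A] [Algebra k A] (ρ : RightComoduleAlgebra k H A) : Prop :=
  ∃ B : H ⊗[k] H →ₗ[k] A, IsRthCasimir ρ B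

/-! ### The canonical coaction on a Clifford algebra -/

namespace Cl

variable {k : Type*} [Field k] {n : ℕ} (α : k) (β γ : Fin n → k) (lam : Fin n → Fin n → k)

/-- The canonical coaction: `ρ(G) = G ⊗ g`, `ρ(X_i) = X_i ⊗ g + 1 ⊗ x_i`. -/
def coactHom : Cl α β γ lam →ₐ[k] Cl α β γ lam ⊗[k] E k n :=
  lift (G α β γ lam ⊗ₜ E.g k n) (fun i => X α β γ lam i ⊗ₜ E.g k n + 1 ⊗ₜ E.x k i)
    (by
      rw [Algebra.TensorProduct.tmul_mul_tmul, G_mul_G, E.g_mul_g,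
        Algebra.TensorProduct.algebraMap_apply])
    (fun i => by
      simp only [mul_add, add_mul, Algebra.TensorProduct.tmul_mul_tmul, X_mul_X, E.g_mul_g,
        E.x_mul_x, E.g_mul_x, mul_one, one_mul, TensorProduct.tmul_zero, TensorProduct.tmul_neg,
        Algebra.TensorProduct.algebraMap_apply]
      abel)
    (fun i => by
      simp only [mul_add, add_mul, Algebra.TensorProduct.tmul_mul_tmul, E.g_mul_g, E.g_mul_x,
        mul_one, one_mul, TensorProduct.tmul_neg, Algebra.TensorProduct.algebraMap_apply,
        ← G_mul_X_add α β γ lam i, TensorProduct.add_tmul]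
      abel)
    (fun i j hij => by
      simp only [mul_add, add_mul, Algebra.TensorProduct.tmul_mul_tmul, E.g_mul_g, E.g_mul_x,
        E.x_mul_x_of_lt k i j hij, mul_one, one_mul, TensorProduct.tmul_neg,
        Algebra.TensorProduct.algebraMap_apply, ← X_mul_X_add α β γ lam i j hij,
        TensorProduct.add_tmul]
      abel)

theorem coactHom_G : coactHom α β γ lam (G α β γ lam) = G α β γ lam ⊗ₜ E.g k n := lift_G ..

theorem coactHom_X (i : Fin n) :
    coactHom α β γ lam (X α β γ lam i) = X α β γ lam i ⊗ₜ E.g k n + 1 ⊗ₜ E.x k i := lift_X ..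

theorem coactHom_G_mul_X (i : Fin n) :
    coactHom α β γ lam (G α β γ lam * X α β γ lam i)
      = (G α β γ lam * X α β γ lam i) ⊗ₜ 1 + G α β γ lam ⊗ₜ (E.g k n * E.x k i) := by
  rw [map_mul, coactHom_G, coactHom_X, mul_add, Algebra.TensorProduct.tmul_mul_tmul,
    Algebra.TensorProduct.tmul_mul_tmul, E.g_mul_g, mul_one]

theorem coactHom_coassoc :
    (Algebra.TensorProduct.assoc k k k (Cl α β γ lam) (E k n) (E k n)).toAlgHom.comp
      ((Algebra.TensorProduct.map (coactHom α β γ lam) (.id k (E k n))).comp (coactHom α β γ lam))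
      = (Algebra.TensorProduct.map (.id k (Cl α β γ lam)) (E.comulHom k n)).comp
          (coactHom α β γ lam) := by
  apply algHom_ext
  · simp [coactHom_G, E.comulHom_g]
  · intro i
    simp [coactHom_X, E.comulHom_x, E.comulHom_g, TensorProduct.add_tmul, TensorProduct.tmul_add,
      Algebra.TensorProduct.one_def, add_assoc]

theorem coactHom_counit :
    (Algebra.TensorProduct.rid k k (Cl α β γ lam)).toAlgHom.comp
      ((Algebra.TensorProduct.map (.id k (Cl α β γ lam)) (E.counitHom k n)).comp
        (coactHom α β γ lam)) = .id k (Cl α β γ lam) := by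
  apply algHom_ext
  · simp [coactHom_G, E.counitHom_g]
  · intro i
    simp [coactHom_X, E.counitHom_x, E.counitHom_g]

/-- The canonical `E(n)`-comodule algebra structure of `Cl(α, β_i, γ_i, λ_ij)`. -/
def canonicalCoaction : RightComoduleAlgebra k (E k n) (Cl α β γ lam) where
  coact := coactHom α β γ lam
  coassoc a := DFunLike.congr_fun (coactHom_coassoc α β γ lam) a
  counit a := DFunLike.congr_fun (coactHom_counit α β γ lam) a

end Cl

/-! ### The explicit Casimir element -/

/-- `x_P = x_{i_1} ⋯ x_{i_s}` for `P = {i_1 < ⋯ < i_s}`, in any monoid. -/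
def orderedProd {M : Type*} [Monoid M] {n : ℕ} (x : Fin n → M) (P : Finset (Fin n)) : M :=
  ((P.sort (· ≤ ·)).map x).prod

/-- For `P = {i_1 < ⋯ < i_s}` and `F = {i_{j_1}, …, i_{j_r}} ⊆ P`, the number
`S(F, P) = (j_1 + ⋯ + j_r) - r (r + 1) / 2`. The position of `f` in `P` is the number of
elements `p ≤ f` of `P`; the subtraction never truncates. -/
def signExp {n : ℕ} (F P : Finset (Fin n)) : ℕ :=
  (∑ f ∈ F, (P.filter (fun p => p ≤ f)).card) - F.card * (F.card + 1) / 2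

/-- The closed formula for `B^A(1 ⊗ x_Q)`. -/
def casimirValue {k : Type*} [Field k] {n : ℕ} (α : k) (β γ : Fin n → k)
    (lam : Fin n → Fin n → k) (Q : Finset (Fin n)) : Cl α β γ lam :=
  ∑ R ∈ Q.powerset.filter (fun R => R.card % 2 = Q.card % 2),
      ((-1 : k) ^ (signExp (Q \ R) Q + (Q.card - R.card) / 2)
        * ((∏ j ∈ Q \ R, γ j)
          / ((2 : k) ^ (Q.card - R.card) * α ^ ((Q.card - R.card) / 2)))) •
        orderedProd (Cl.X α β γ lam) R
    + ∑ R ∈ Q.powerset.filter (fun R => R.card % 2 ≠ Q.card % 2),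
      ((-1 : k) ^ (signExp (Q \ R) Q + (Q.card - R.card + 1) / 2)
        * ((∏ j ∈ Q \ R, γ j)
          / ((2 : k) ^ (Q.card - R.card) * α ^ ((Q.card - R.card + 1) / 2)))) •
        (Cl.G α β γ lam * orderedProd (Cl.X α β γ lam) R)

/-- `B` is given by the explicit formulas with parameter `μ`. -/
structure IsExplicitCasimir {k : Type*} [Field k] {n : ℕ} {α : k} {β γ : Fin n → k}
    {lam : Fin n → Fin n → k} (μ : k) (B : E k n ⊗[k] E k n →ₗ[k] Cl α β γ lam) : Prop where
  /-- `B(g^j x_P ⊗ g^l x_Q) = B(1 ⊗ S(g^j x_P) g^l x_Q)` for `j, l ∈ {0, 1}`. -/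
  reduce : ∀ (j l : Fin 2) (P Q : Finset (Fin n)),
    B ((E.g k n ^ (j : ℕ) * orderedProd (E.x k) P) ⊗ₜ (E.g k n ^ (l : ℕ) * orderedProd (E.x k) Q))
      = B (1 ⊗ₜ (HopfAlgebra.antipode k (E.g k n ^ (j : ℕ) * orderedProd (E.x k) P)
          * (E.g k n ^ (l : ℕ) * orderedProd (E.x k) Q)))
  /-- The value `B(1 ⊗ x_Q)`. -/
  value_x : ∀ Q : Finset (Fin n), B (1 ⊗ₜ orderedProd (E.x k) Q) = casimirValue α β γ lam Q
  /-- `B(1 ⊗ g x_Q) = (μ G) B(1 ⊗ x_Q)`. -/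
  value_gx : ∀ Q : Finset (Fin n),
    B (1 ⊗ₜ (E.g k n * orderedProd (E.x k) Q))
      = (μ • Cl.G α β γ lam) * B (1 ⊗ₜ orderedProd (E.x k) Q)

end

end CliffordCowreath

namespace CliffordCowreath

noncomputable section

/-! The identity $B(h_1h'\otimes h_2h'')=\varepsilon(h)B(h'\otimes h'')$ says that $B(h\otimes
h')=f(S(h)h')$ with $f(h)=B(1\otimes h)$ (`IsRthCasimir.apply_tmul`). The heaviness identity,
normalization and surjectivity of $S$ make $f$ an algebra map $E(n)\to A$, and it is colinear. So
Casimir elements come from colinear algebra maps.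

Such maps are rigid. Both $f(g)$ and $f(x_i)-X_i$ satisfy $\rho(a)=a\otimes g$, and the only such
elements are the multiples of $G$ (`Cl.exists_eq_smul_G_of_coact`). Hence $f(g)=\mu G$ and
$f(x_i)=X_i+d_iG$. The relations of $E(n)$ then force $\mu^2\alpha=1$, $d_i=-\gamma_i/(2\alpha)$ and
the values of $\beta_i$, $\lambda_{ij}$ (`IsRthCasimir.exists_parameter`); this uses that scalars
embed in $A$, which holds because a Clifford algebra is linearly an exterior algebra when $2\ne0$.

Conversely, under these conditions $f$ exists, and the remaining bimodule identity needs checking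
only on $G$ and $X_i$ (`isRthCasimir_antipodeTwist`). The closed formula is the expansion of the
ordered product of the $X_i-\frac{\gamma_i}{2\alpha}G$, which anticommute with $G$
(`orderedProd_shiftedX`). Uniqueness of $B$ rests on the basis $g^jx_P$ of $E(n)=Cl(1,0,0,0)$. -/

/-! ### Ordered products. -/

theorem orderedProd_empty {M : Type*} [Monoid M] {n : ℕ} (x : Fin n → M) :
    orderedProd x ∅ = 1 := by
  simp [orderedProd]

theorem orderedProd_insert_max {M : Type*} [Monoid M] {n : ℕ} (x : Fin n → M)
    {m : Fin n} {s : Finset (Fin n)} (hm : ∀ i ∈ s, i < m) :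
    orderedProd x (insert m s) = orderedProd x s * x m := by
  have hnot : m ∉ s := fun h => lt_irrefl _ (hm m h)
  have h : (insert m s).sort (· ≤ ·) = s.sort (· ≤ ·) ++ [m] := by
    have hnd : (s.sort (· ≤ ·) ++ [m]).Nodup := by
      rw [List.nodup_append]
      refine ⟨Finset.sort_nodup _ _, by simp, ?_⟩
      intro a ha b hb
      simp only [Finset.mem_sort, List.mem_singleton] at ha hb
      exact hb ▸ (hm a ha).ne
    have := (List.toFinset_sort (· ≤ ·) hnd).mpr (by
      rw [List.pairwise_append]
      refine ⟨Finset.pairwise_sort _ _, by simp, ?_⟩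
      intro a ha b hb
      simp only [Finset.mem_sort, List.mem_singleton] at ha hb
      exact hb ▸ (hm a ha).le)
    rw [← this]
    congr 1
    ext i
    simp
  simp [orderedProd, h]

theorem map_orderedProd {M N F : Type*} [Monoid M] [Monoid N] [FunLike F M N]
    [MonoidHomClass F M N] (f : F) {n : ℕ} (x : Fin n → M) (P : Finset (Fin n)) :
    f (orderedProd x P) = orderedProd (fun i => f (x i)) P := by
  simp [orderedProd, map_list_prod, Function.comp_def]

/-! ### Structure of the Clifford algebras: scalars, skew derivations, independence of monomials. -/

namespace Cl

variable {k : Type*} [Field k] {n : ℕ} {α : k} {β γ : Fin n → k} {lam : Fin n → Fin n → k}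

theorem induction {p : Cl α β γ lam → Prop} (hc : ∀ c : k, p (algebraMap k _ c))
    (hG : p (G α β γ lam)) (hX : ∀ i, p (X α β γ lam i)) (hmul : ∀ a b, p a → p b → p (a * b))
    (hadd : ∀ a b, p a → p b → p (a + b)) (a : Cl α β γ lam) : p a := by
  obtain ⟨u, rfl⟩ : ∃ u, mk α β γ lam u = a := RingQuot.mkAlgHom_surjective k (ClRel α β γ lam) a
  induction u using FreeAlgebra.induction with
  | grade0 c => rw [AlgHom.commutes]; exact hc c
  | grade1 o =>
    cases o with
    | none => exact hG
    | some i => exact hX i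
  | mul a b ha hb => rw [map_mul]; exact hmul _ _ ha hb
  | add a b ha hb => rw [map_add]; exact hadd _ _ ha hb

/-- An upper triangular Gram matrix of the quadratic form of `Cl(α, β_i, γ_i, λ_ij)`. -/
def gram (α : k) (β γ : Fin n → k) (lam : Fin n → Fin n → k) :
    Matrix (Option (Fin n)) (Option (Fin n)) k
  | none, none => α
  | none, some i => γ i
  | some _, none => 0
  | some i, some j => if i = j then β i else if i < j then lam i j else 0

/-- The quadratic form of `Cl(α, β_i, γ_i, λ_ij)`. -/
def quadForm (α : k) (β γ : Fin n → k) (lam : Fin n → Fin n → k) :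
    QuadraticForm k (Option (Fin n) → k) :=
  LinearMap.BilinMap.toQuadraticMap (Matrix.toBilin' (gram α β γ lam))

/-- As `gram` is triangular, for $u\ne v$ one of the two entries is zero and the sum is exactly
$\gamma_i$ or $\lambda_{ij}$, without halving. -/
theorem polar_quadForm_single (u v : Option (Fin n)) :
    QuadraticMap.polar (quadForm α β γ lam) (Pi.single u 1) (Pi.single v 1)
      = gram α β γ lam u v + gram α β γ lam v u := by
  simp [quadForm, LinearMap.BilinMap.polar_toQuadraticMap, Matrix.toBilin'_single]

theorem quadForm_single (u : Option (Fin n)) :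
    quadForm α β γ lam (Pi.single u 1) = gram α β γ lam u u := by
  simp [quadForm, Matrix.toBilin'_single]

/-- The comparison map to the Clifford algebra of the quadratic form. -/
def toClifford : Cl α β γ lam →ₐ[k] CliffordAlgebra (quadForm α β γ lam) :=
  lift (CliffordAlgebra.ι _ (Pi.single none 1)) (fun i => CliffordAlgebra.ι _ (Pi.single (some i) 1))
    (by rw [CliffordAlgebra.ι_sq_scalar, quadForm_single]; rfl)
    (fun i => by rw [CliffordAlgebra.ι_sq_scalar, quadForm_single]; simp [gram])
    (fun i => by
      rw [CliffordAlgebra.ι_mul_ι_add_swap, polar_quadForm_single]; simp [gram])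
    (fun i j hij => by
      rw [CliffordAlgebra.ι_mul_ι_add_swap, polar_quadForm_single]
      simp [gram, hij, hij.ne, hij.ne', hij.not_gt])

/-- The linear isomorphism of a Clifford algebra with the exterior algebra, available when 2 is
invertible, fixes scalars, and scalars are faithful in the latter. Every comparison of coefficients
below rests on this. -/
theorem algebraMap_injective (hk : (2 : k) ≠ 0) :
    Function.Injective (algebraMap k (Cl α β γ lam)) := by
  let _ : Invertible (2 : k) := invertibleOfNonzero hk
  have h : ∀ c : k, CliffordAlgebra.equivExterior (quadForm α β γ lam)
      (toClifford (algebraMap k (Cl α β γ lam) c)) = algebraMap k _ c := by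
    intro c
    rw [AlgHom.commutes]
    simp
  intro c d hcd
  have := h c
  rw [hcd, h d] at this
  exact ((ExteriorAlgebra.algebraMap_inj _ _ _).mp this).symm

/-- The algebra map `E(n) → M_2(k)` with `g ↦ diag(1, -1)`, `x_m ↦ e_{01}` and `x_j ↦ 0`
for `j ≠ m`. -/
def matrixRep (k : Type*) [Field k] {n : ℕ} (m : Fin n) : E k n →ₐ[k] Matrix (Fin 2) (Fin 2) k :=
  E.lift !![1, 0; 0, -1] (fun j => if j = m then !![0, 1; 0, 0] else 0)
    (by simp [Matrix.one_fin_two])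
    (fun i => by
      split_ifs
      · ext a b
        fin_cases a <;> fin_cases b <;> simp
      · simp)
    (fun i => by split_ifs <;> simp)
    (fun i j hij => by
      split_ifs with h1 h2
      · exact absurd (h1.trans h2.symm) hij.ne
      all_goals simp)

/-- The algebra map `A → M_2(A)` whose upper right entry is the skew derivation
dual to `x_m`. -/
def skewDeriv (m : Fin n) : Cl α β γ lam →ₐ[k] Matrix (Fin 2) (Fin 2) (Cl α β γ lam) :=
  (matrixEquivTensor (Fin 2) k (Cl α β γ lam)).symm.toAlgHom.comp
    ((Algebra.TensorProduct.map (.id k _) (matrixRep k m)).comp (coactHom α β γ lam))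

theorem skewDeriv_G (m : Fin n) :
    skewDeriv m (G α β γ lam) = !![G α β γ lam, 0; 0, -G α β γ lam] := by
  simp only [skewDeriv, AlgHom.comp_apply, coactHom_G, Algebra.TensorProduct.map_tmul, matrixRep,
    E.lift_g]
  ext i j
  fin_cases i <;> fin_cases j <;> simp [matrixEquivTensor_apply_symm]

theorem skewDeriv_X_self (m : Fin n) :
    skewDeriv m (X α β γ lam m) = !![X α β γ lam m, 1; 0, -X α β γ lam m] := by
  simp only [skewDeriv, AlgHom.comp_apply, coactHom_X, Algebra.TensorProduct.map_tmul, matrixRep,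
    E.lift_g, E.lift_x, map_add]
  ext i j
  fin_cases i <;> fin_cases j <;> simp [matrixEquivTensor_apply_symm]

theorem skewDeriv_X_of_ne {m i : Fin n} (hi : i ≠ m) :
    skewDeriv m (X α β γ lam i) = !![X α β γ lam i, 0; 0, -X α β γ lam i] := by
  simp only [skewDeriv, AlgHom.comp_apply, coactHom_X, Algebra.TensorProduct.map_tmul, matrixRep,
    E.lift_g, E.lift_x, map_add]
  ext a b
  fin_cases a <;> fin_cases b <;> simp [matrixEquivTensor_apply_symm, hi]

/-- `matrixRep` sends $g$ to a diagonal matrix, so $a\otimes g$ has no off-diagonal part. -/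
theorem skewDeriv_of_coact {m : Fin n} {a : Cl α β γ lam}
    (h : coactHom α β γ lam a = a ⊗ₜ E.g k n) : skewDeriv m a 0 1 = 0 := by
  simp [skewDeriv, h, matrixRep, E.lift_g, matrixEquivTensor_apply_symm]

variable (α β γ lam) in
/-- The subalgebra generated by `G` and the `X_i` with `i ∈ s`. -/
def partialSubalgebra (s : Finset (Fin n)) : Subalgebra k (Cl α β γ lam) :=
  Algebra.adjoin k (insert (G α β γ lam) (X α β γ lam '' s))

theorem G_mem (s : Finset (Fin n)) : G α β γ lam ∈ partialSubalgebra α β γ lam s :=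
  Algebra.subset_adjoin (Set.mem_insert _ _)

theorem X_mem {s : Finset (Fin n)} {i : Fin n} (hi : i ∈ s) :
    X α β γ lam i ∈ partialSubalgebra α β γ lam s :=
  Algebra.subset_adjoin (Set.mem_insert_of_mem _ ⟨i, hi, rfl⟩)

theorem partialSubalgebra_univ :
    partialSubalgebra α β γ lam Finset.univ = ⊤ := by
  rw [eq_top_iff]
  intro a _
  induction a using induction with
  | hc c => exact Subalgebra.algebraMap_mem _ c
  | hG => exact G_mem _
  | hX i => exact X_mem (Finset.mem_univ i)
  | hmul a b ha hb => exact mul_mem (ha trivial) (hb trivial)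
  | hadd a b ha hb => exact add_mem (ha trivial) (hb trivial)

theorem skewDeriv_mem {m : Fin n} {s : Finset (Fin n)} (hm : m ∉ s) {a : Cl α β γ lam}
    (ha : a ∈ partialSubalgebra α β γ lam s) : ∃ d, skewDeriv m a = !![a, 0; 0, d] := by
  induction ha using Algebra.adjoin_induction with
  | mem u hu =>
    rcases hu with rfl | ⟨i, hi, rfl⟩
    · exact ⟨_, skewDeriv_G m⟩
    · exact ⟨_, skewDeriv_X_of_ne (fun h => hm (h ▸ hi))⟩
  | algebraMap c =>
    refine ⟨algebraMap k _ c, ?_⟩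
    rw [AlgHom.commutes]
    ext i j
    fin_cases i <;> fin_cases j <;> simp [Matrix.algebraMap_matrix_apply]
  | add u v _ _ hu hv =>
    obtain ⟨d, hd⟩ := hu
    obtain ⟨e, he⟩ := hv
    exact ⟨d + e, by simp [hd, he]⟩
  | mul u v _ _ hu hv =>
    obtain ⟨d, hd⟩ := hu
    obtain ⟨e, he⟩ := hv
    exact ⟨d * e, by simp [hd, he]⟩

/-- The images of $b$ and $c$ are diagonal with upper left entries $b$ and $c$, while that of $X_m$
has upper right entry 1. Thus the skew derivation reads off the coefficient of $X_m$. -/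
theorem skewDeriv_add_mul_X {m : Fin n} {s : Finset (Fin n)} (hm : m ∉ s) {b c : Cl α β γ lam}
    (hb : b ∈ partialSubalgebra α β γ lam s) (hc : c ∈ partialSubalgebra α β γ lam s) :
    skewDeriv m (b + c * X α β γ lam m) 0 1 = c := by
  obtain ⟨d, hd⟩ := skewDeriv_mem hm hb
  obtain ⟨e, he⟩ := skewDeriv_mem hm hc
  simp [hd, he, skewDeriv_X_self]

theorem X_mul_X_of_ne (i j : Fin n) (hij : i ≠ j) : ∃ c : k,
    X α β γ lam i * X α β γ lam j = algebraMap k _ c - X α β γ lam j * X α β γ lam i := by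
  rcases hij.lt_or_gt with h | h
  · exact ⟨lam i j, eq_sub_of_add_eq (X_mul_X_add α β γ lam i j h)⟩
  · exact ⟨lam j i, eq_sub_of_add_eq' (X_mul_X_add α β γ lam j i h)⟩

theorem exists_eq_add_mul_X {m : Fin n} {s : Finset (Fin n)} {a : Cl α β γ lam} (hm : m ∉ s)
    (ha : a ∈ partialSubalgebra α β γ lam (insert m s)) :
    ∃ b ∈ partialSubalgebra α β γ lam s, ∃ c ∈ partialSubalgebra α β γ lam s,
      a = b + c * X α β γ lam m := by
  -- Right multiplication by $a$ is shown to preserve $A_s+A_sX_m$, with $A_s$ the subalgebra for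
  -- $s$; this property passes to products. Applied to $1$, it gives the claim.
  suffices h : ∀ b ∈ partialSubalgebra α β γ lam s, ∀ c ∈ partialSubalgebra α β γ lam s,
      ∃ b' ∈ partialSubalgebra α β γ lam s, ∃ c' ∈ partialSubalgebra α β γ lam s,
      (b + c * X α β γ lam m) * a = b' + c' * X α β γ lam m by
    simpa using h 1 (one_mem _) 0 (zero_mem _)
  induction ha using Algebra.adjoin_induction with
  | mem u hu =>
    intro b hb c hc
    rcases hu with rfl | ⟨i, hi, rfl⟩
    · refine ⟨b * G α β γ lam + c * algebraMap k _ (γ m), ?_, -(c * G α β γ lam), ?_, ?_⟩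
      · exact add_mem (mul_mem hb (G_mem _)) (mul_mem hc (Subalgebra.algebraMap_mem _ _))
      · exact neg_mem (mul_mem hc (G_mem _))
      · rw [← G_mul_X_add α β γ lam m]
        noncomm_ring
    · by_cases him : i = m
      · subst him
        refine ⟨c * algebraMap k _ (β i), mul_mem hc (Subalgebra.algebraMap_mem _ _), b, hb, ?_⟩
        rw [add_mul, mul_assoc, X_mul_X, add_comm]
      · have hi' : i ∈ s := by simpa [him] using hi
        obtain ⟨e, he⟩ := X_mul_X_of_ne (α := α) (β := β) (γ := γ) (lam := lam) m i (Ne.symm him)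
        refine ⟨b * X α β γ lam i + c * algebraMap k _ e, ?_, -(c * X α β γ lam i), ?_, ?_⟩
        · exact add_mem (mul_mem hb (X_mem hi')) (mul_mem hc (Subalgebra.algebraMap_mem _ _))
        · exact neg_mem (mul_mem hc (X_mem hi'))
        · rw [add_mul, mul_assoc, he]
          noncomm_ring
  | algebraMap e =>
    intro b hb c hc
    refine ⟨b * algebraMap k _ e, mul_mem hb (Subalgebra.algebraMap_mem _ _),
      c * algebraMap k _ e, mul_mem hc (Subalgebra.algebraMap_mem _ _), ?_⟩
    rw [add_mul, mul_assoc, mul_assoc, Algebra.commutes e (X α β γ lam m)]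
  | add u v _ _ hu hv =>
    intro b hb c hc
    obtain ⟨b₁, hb₁, c₁, hc₁, h₁⟩ := hu b hb c hc
    obtain ⟨b₂, hb₂, c₂, hc₂, h₂⟩ := hv b hb c hc
    refine ⟨b₁ + b₂, add_mem hb₁ hb₂, c₁ + c₂, add_mem hc₁ hc₂, ?_⟩
    rw [mul_add, h₁, h₂, add_mul]
    abel
  | mul u v _ _ hu hv =>
    intro b hb c hc
    obtain ⟨b₁, hb₁, c₁, hc₁, h₁⟩ := hu b hb c hc
    obtain ⟨b₂, hb₂, c₂, hc₂, h₂⟩ := hv b₁ hb₁ c₁ hc₁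
    exact ⟨b₂, hb₂, c₂, hc₂, by rw [← mul_assoc, h₁, h₂]⟩

theorem exists_of_mem_partialSubalgebra_empty {a : Cl α β γ lam}
    (ha : a ∈ partialSubalgebra α β γ lam ∅) :
    ∃ u v : k, a = algebraMap k _ u + v • G α β γ lam := by
  induction ha using Algebra.adjoin_induction with
  | mem u hu =>
    obtain rfl : u = G α β γ lam := by simpa using hu
    exact ⟨0, 1, by simp⟩
  | algebraMap c => exact ⟨c, 0, by simp⟩
  | add u v _ _ hu hv =>
    obtain ⟨a, b, rfl⟩ := hu
    obtain ⟨c, d, rfl⟩ := hv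
    exact ⟨a + c, b + d, by simp only [map_add, add_smul]; abel⟩
  | mul u v _ _ hu hv =>
    obtain ⟨a, b, rfl⟩ := hu
    obtain ⟨c, d, rfl⟩ := hv
    refine ⟨a * c + b * d * α, a * d + b * c, ?_⟩
    simp only [Algebra.algebraMap_eq_smul_one, add_mul, mul_add, smul_mul_assoc, mul_smul_comm,
      one_mul, mul_one, G_mul_G, smul_smul, add_smul]
    module

/-- The parity automorphism `G ↦ -G`, `X_i ↦ -X_i`. -/
def parity : Cl α β γ lam →ₐ[k] Cl α β γ lam :=
  lift (-G α β γ lam) (fun i => -X α β γ lam i) (by simp [G_mul_G]) (by simp [X_mul_X])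
    (by simp [G_mul_X_add]) (by simpa using X_mul_X_add α β γ lam)

theorem parity_G : parity (G α β γ lam) = -G α β γ lam := lift_G ..

theorem parity_of_coact {a : Cl α β γ lam} (h : coactHom α β γ lam a = a ⊗ₜ E.g k n) :
    parity a = -a := by
  -- Applying the character $g\mapsto-1$, $x_i\mapsto0$ to the second factor of $\rho$ yields the
  -- parity automorphism, and sends $a\otimes g$ to $-a$.
  let χ : E k n →ₐ[k] k := E.lift (-1) (fun _ => 0) (by simp) (by simp) (by simp) (by simp)
  have hχ : ((Algebra.TensorProduct.rid k k (Cl α β γ lam)).toAlgHom.comp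
      ((Algebra.TensorProduct.map (.id k _) χ).comp (coactHom α β γ lam))) = parity := by
    apply algHom_ext
    · simp [coactHom_G, parity, lift_G, χ, E.lift_g]
    · intro i
      simp [coactHom_X, parity, lift_X, χ, E.lift_g, E.lift_x]
  rw [← hχ]
  simp [h, χ, E.lift_g]

/-- The elements with `ρ(a) = a ⊗ g` are the multiples of `G`. -/
theorem exists_eq_smul_G_of_coact (hk : (2 : k) ≠ 0) {a : Cl α β γ lam}
    (h : coactHom α β γ lam a = a ⊗ₜ E.g k n) : ∃ c : k, a = c • G α β γ lam := by
  -- Generators are removed one at a time: in $a=b+cX_m$ the coefficient $c$ is a skew derivative of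
  -- $a$, hence zero.
  have key : ∀ s : Finset (Fin n), a ∈ partialSubalgebra α β γ lam s →
      a ∈ partialSubalgebra α β γ lam ∅ := by
    intro s
    induction s using Finset.induction_on with
    | empty => exact id
    | insert m s hm ih =>
      intro ha
      obtain ⟨b, hb, c, hc, rfl⟩ := exists_eq_add_mul_X hm ha
      have h0 := skewDeriv_add_mul_X hm hb hc
      rw [skewDeriv_of_coact h] at h0
      subst h0
      exact ih (by simpa using hb)
  obtain ⟨u, v, rfl⟩ := exists_of_mem_partialSubalgebra_empty
    (key Finset.univ (by rw [partialSubalgebra_univ]; trivial))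
  -- Now $a=u+vG$. Parity fixes $u$ but must send $a$ to $-a$, so $2u=0$.
  have h1 := parity_of_coact h
  rw [map_add, AlgHom.commutes, map_smul, parity_G] at h1
  have h2 : (2 : k) • algebraMap k (Cl α β γ lam) u = 0 := by
    rw [two_smul]
    have : ∀ x y : Cl α β γ lam, x + -y = -(x + y) → x + x = 0 := by
      intro x y hxy
      rw [neg_add] at hxy
      exact add_eq_zero_iff_eq_neg.mpr (add_right_cancel hxy)
    exact this _ _ (by rw [smul_neg] at h1; exact h1)
  rw [smul_eq_zero_iff_right hk] at h2
  exact ⟨v, by rw [h2, zero_add]⟩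

theorem orderedProd_mem (s P : Finset (Fin n)) (hP : P ⊆ s) :
    orderedProd (X α β γ lam) P ∈ partialSubalgebra α β γ lam s := by
  refine Submonoid.list_prod_mem (partialSubalgebra α β γ lam s).toSubmonoid ?_
  intro y hy
  obtain ⟨i, hi, rfl⟩ := List.mem_map.mp hy
  exact X_mem (hP (by simpa using hi))

/-- Splitting off the largest index $m$ writes the sum as $b+cX_m$; the skew derivation at $m$ gives
$c=0$, then $b=0$, and induction applies to both. -/
theorem coeff_eq_zero_of_sum_eq_zero (hk : (2 : k) ≠ 0) (hα : α ≠ 0) (s : Finset (Fin n))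
    (c d : Finset (Fin n) → k)
    (h : ∑ P ∈ s.powerset, (c P • orderedProd (X α β γ lam) P
      + d P • (G α β γ lam * orderedProd (X α β γ lam) P)) = 0) :
    ∀ P ⊆ s, c P = 0 ∧ d P = 0 := by
  induction s using Finset.induction_on_max generalizing c d with
  | empty =>
    simp only [Finset.powerset_empty, Finset.sum_singleton, orderedProd_empty, mul_one] at h
    -- Adding the parity image cancels the $G$-term and leaves twice the constant coefficient.
    have h1 := congrArg parity h
    simp only [map_add, map_smul, map_one, parity_G, map_zero] at h1
    have hinj := algebraMap_injective (α := α) (β := β) (γ := γ) (lam := lam) hk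
    have h2 : (2 * c ∅) • (1 : Cl α β γ lam) = 0 := by
      rw [mul_smul, two_smul]
      have := congrArg₂ (· + ·) h h1
      simp only [smul_neg, add_zero] at this
      rw [← this]
      abel
    have hc : c ∅ = 0 := by
      have := hinj (a₁ := 2 * c ∅) (a₂ := 0) (by rw [Algebra.algebraMap_eq_smul_one, h2, map_zero])
      simpa [hk] using this
    have hd : d ∅ = 0 := by
      rw [hc, zero_smul, zero_add] at h
      -- Multiplying $dG=0$ by $G$ gives the scalar equation $d\alpha=0$.
      have h3 := congrArg (· * G α β γ lam) h
      simp only [smul_mul_assoc, G_mul_G, zero_mul] at h3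
      rw [Algebra.smul_def, ← map_mul, ← map_zero (algebraMap k (Cl α β γ lam))] at h3
      simpa [hα] using hinj h3
    intro P hP
    obtain rfl := Finset.subset_empty.mp hP
    exact ⟨hc, hd⟩
  | insert m s hm ih =>
    have hnot : m ∉ s := fun h => lt_irrefl _ (hm m h)
    rw [Finset.sum_powerset_insert hnot] at h
    have hsplit : ∑ P ∈ s.powerset, (c (insert m P) • orderedProd (X α β γ lam) (insert m P)
        + d (insert m P) • (G α β γ lam * orderedProd (X α β γ lam) (insert m P)))
        = (∑ P ∈ s.powerset, (c (insert m P) • orderedProd (X α β γ lam) P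
          + d (insert m P) • (G α β γ lam * orderedProd (X α β γ lam) P))) * X α β γ lam m := by
      rw [Finset.sum_mul]
      refine Finset.sum_congr rfl fun P hP => ?_
      rw [orderedProd_insert_max _ fun i hi => hm i (Finset.mem_powerset.mp hP hi)]
      simp [add_mul, mul_assoc]
    rw [hsplit] at h
    have hmem : ∀ c d : Finset (Fin n) → k, ∑ P ∈ s.powerset, (c P • orderedProd (X α β γ lam) P
        + d P • (G α β γ lam * orderedProd (X α β γ lam) P)) ∈ partialSubalgebra α β γ lam s := by
      intro c d
      refine sum_mem fun P hP => ?_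
      have hP' := orderedProd_mem (α := α) (β := β) (γ := γ) (lam := lam) s P
        (Finset.mem_powerset.mp hP)
      exact add_mem (Subalgebra.smul_mem _ hP' _)
        (Subalgebra.smul_mem _ (mul_mem (G_mem _) hP') _)
    have h1 := skewDeriv_add_mul_X hnot (hmem c d)
      (hmem (fun P => c (insert m P)) (fun P => d (insert m P)))
    rw [h, map_zero] at h1
    have h1' := h1.symm
    simp only [Matrix.zero_apply] at h1'
    rw [h1', zero_mul, add_zero] at h
    intro P hP
    by_cases hmP : m ∈ P
    · have := ih (fun P => c (insert m P)) (fun P => d (insert m P)) h1' (P.erase m)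
        (by rwa [Finset.subset_insert_iff] at hP)
      simpa [Finset.insert_erase hmP] using this
    · exact ih c d h P ((Finset.subset_insert_iff_of_notMem hmP).mp hP)

end Cl

/-! ### The sign exponent under adjoining a largest element. -/

section Sign

variable {n : ℕ}

theorem filter_le_insert_max {m f : Fin n} {Q : Finset (Fin n)} (hf : f < m) :
    (insert m Q).filter (fun p => p ≤ f) = Q.filter (fun p => p ≤ f) := by
  rw [Finset.filter_insert, if_neg hf.not_ge]

/-- The $r$-th smallest element of $F$ has position at least $r$ in $Q$. Hence the natural
subtraction in `signExp` does not truncate. -/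
theorem card_mul_card_succ_div_two_le {F Q : Finset (Fin n)} (hF : F ⊆ Q) :
    F.card * (F.card + 1) / 2 ≤ ∑ f ∈ F, (Q.filter (fun p => p ≤ f)).card := by
  induction F using Finset.induction_on_max with
  | empty => simp
  | insert m F hm ih =>
    have hnot : m ∉ F := fun h => lt_irrefl _ (hm m h)
    have h1 : (insert m F).card ≤ (Q.filter (fun p => p ≤ m)).card := by
      refine Finset.card_le_card fun i hi => ?_
      refine Finset.mem_filter.mpr ⟨hF hi, ?_⟩
      rcases Finset.mem_insert.mp hi with rfl | h
      · exact le_rfl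
      · exact (hm i h).le
    have h2 := ih ((Finset.subset_insert _ _).trans hF)
    rw [Finset.sum_insert hnot]
    rw [Finset.card_insert_of_notMem hnot] at h1 ⊢
    have h3 : (F.card + 1) * (F.card + 1 + 1) = F.card * (F.card + 1) + (F.card + 1) * 2 := by ring
    rw [h3, Nat.add_mul_div_right _ _ two_pos]
    omega

theorem signExp_insert_right {m : Fin n} {F Q : Finset (Fin n)} (hF : F ⊆ Q)
    (hm : ∀ i ∈ Q, i < m) : signExp F (insert m Q) = signExp F Q := by
  unfold signExp
  congr 1
  exact Finset.sum_congr rfl fun f hf => by rw [filter_le_insert_max (hm f (hF hf))]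

/-- The new element has position $|Q|+1$, while the triangular number grows by $|F|+1$. -/
theorem signExp_insert_insert {m : Fin n} {F Q : Finset (Fin n)} (hF : F ⊆ Q)
    (hm : ∀ i ∈ Q, i < m) :
    signExp (insert m F) (insert m Q) = signExp F Q + (Q.card - F.card) := by
  have hnot : m ∉ Q := fun h => lt_irrefl _ (hm m h)
  have hnotF : m ∉ F := fun h => hnot (hF h)
  unfold signExp
  rw [Finset.sum_insert hnotF, Finset.sum_congr rfl fun f hf => by
    rw [filter_le_insert_max (Q := Q) (hm f (hF hf))]]
  have h1 : (insert m Q).filter (fun p => p ≤ m) = insert m Q := by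
    refine Finset.filter_true_of_mem fun i hi => ?_
    rcases Finset.mem_insert.mp hi with rfl | h
    · exact le_rfl
    · exact (hm i h).le
  have h2 := card_mul_card_succ_div_two_le hF
  have h4 := Finset.card_le_card hF
  rw [h1, Finset.card_insert_of_notMem hnot, Finset.card_insert_of_notMem hnotF]
  have h3 : (F.card + 1) * (F.card + 1 + 1) = F.card * (F.card + 1) + (F.card + 1) * 2 := by ring
  rw [h3, Nat.add_mul_div_right _ _ two_pos]
  omega

end Sign

/-! ### The closed formula as an ordered product. -/

section Values

variable {k : Type*} [Field k] {n : ℕ} (α : k) (β γ : Fin n → k) (lam : Fin n → Fin n → k)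

/-- The summand of `casimirValue` at `R ⊆ Q`. -/
def casimirTerm (Q R : Finset (Fin n)) : Cl α β γ lam :=
  ((-1 : k) ^ (signExp (Q \ R) Q + (Q.card - R.card + 1) / 2)
    * ((∏ j ∈ Q \ R, γ j) / ((2 : k) ^ (Q.card - R.card) * α ^ ((Q.card - R.card + 1) / 2)))) •
    (Cl.G α β γ lam ^ ((Q.card - R.card) % 2) * orderedProd (Cl.X α β γ lam) R)

/-- With $d=|Q|-|R|$, the integer part of $(d+1)/2$ is $d/2$ or $(d+1)/2$ by parity, and
$G^{d\bmod2}$ supplies the factor $G$ for odd $d$; so one expression covers both sums. -/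
theorem casimirValue_eq_sum (Q : Finset (Fin n)) :
    casimirValue α β γ lam Q = ∑ R ∈ Q.powerset, casimirTerm α β γ lam Q R := by
  rw [← Finset.sum_filter_add_sum_filter_not Q.powerset (fun R => R.card % 2 = Q.card % 2)]
  unfold casimirValue
  congr 1
  · refine Finset.sum_congr rfl fun R hR => ?_
    obtain ⟨hRQ, hpar⟩ := Finset.mem_filter.mp hR
    have hle := Finset.card_le_card (Finset.mem_powerset.mp hRQ)
    rw [casimirTerm, show (Q.card - R.card) % 2 = 0 by omega,
      show (Q.card - R.card + 1) / 2 = (Q.card - R.card) / 2 by omega, pow_zero, one_mul]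
  · refine Finset.sum_congr rfl fun R hR => ?_
    obtain ⟨hRQ, hpar⟩ := Finset.mem_filter.mp hR
    have hle := Finset.card_le_card (Finset.mem_powerset.mp hRQ)
    rw [casimirTerm, show (Q.card - R.card) % 2 = 1 by omega, pow_one]

variable {α}

theorem casimirTerm_insert_insert {m : Fin n} {Q R : Finset (Fin n)} (hR : R ⊆ Q)
    (hm : ∀ i ∈ Q, i < m) :
    casimirTerm α β γ lam (insert m Q) (insert m R)
      = casimirTerm α β γ lam Q R * Cl.X α β γ lam m := by
  have hnot : m ∉ Q := fun h => lt_irrefl _ (hm m h)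
  have hnotR : m ∉ R := fun h => hnot (hR h)
  have hsd : insert m Q \ insert m R = Q \ R := by
    rw [Finset.insert_sdiff_insert, Finset.sdiff_insert_of_notMem hnot]
  unfold casimirTerm
  rw [hsd, signExp_insert_right Finset.sdiff_subset hm, Finset.card_insert_of_notMem hnot,
    Finset.card_insert_of_notMem hnotR, Nat.add_sub_add_right,
    orderedProd_insert_max _ fun i hi => hm i (hR hi), smul_mul_assoc, mul_assoc]

/-- The index $m$ joins $Q\setminus R$, contributing $\gamma_m/2$ and the sign $(-1)^{|R|}$; the
parity of $|Q|-|R|$ flips, which is matched by one more $G$. -/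
theorem casimirTerm_insert (hk : (2 : k) ≠ 0) (hα : α ≠ 0) {m : Fin n} {Q R : Finset (Fin n)}
    (hR : R ⊆ Q) (hm : ∀ i ∈ Q, i < m) :
    casimirTerm α β γ lam (insert m Q) R
      = ((-1) ^ Q.card * -(γ m / (2 * α))) • (Cl.G α β γ lam * casimirTerm α β γ lam Q R) := by
  have hnot : m ∉ Q := fun h => lt_irrefl _ (hm m h)
  have hnotR : m ∉ R := fun h => hnot (hR h)
  have hle := Finset.card_le_card hR
  have hsd : insert m Q \ R = insert m (Q \ R) := Finset.insert_sdiff_of_notMem _ hnotR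
  have hnot' : m ∉ Q \ R := fun h => hnot (Finset.sdiff_subset h)
  unfold casimirTerm
  rw [hsd, signExp_insert_insert Finset.sdiff_subset hm, Finset.card_insert_of_notMem hnot,
    Finset.prod_insert hnot', Finset.card_sdiff_of_subset hR, Nat.sub_sub_self hle,
    Nat.sub_add_comm hle, mul_smul_comm, smul_smul, ← mul_assoc (Cl.G α β γ lam), ← pow_succ']
  obtain ⟨d, hd⟩ := Nat.exists_eq_add_of_le hle
  rw [hd, Nat.add_sub_cancel_left]
  generalize signExp (Q \ R) Q = S
  generalize R.card = r
  rcases Nat.even_or_odd' d with ⟨e, rfl | rfl⟩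
  · rw [show (2 * e + 1 + 1) / 2 = e + 1 by omega, show (2 * e + 1) / 2 = e by omega,
      show (2 * e + 1) % 2 = 1 by omega, show 2 * e % 2 + 1 = 1 by omega]
    congr 1
    have : (-1 : k) ^ (r + 2 * e) = (-1) ^ r := by rw [pow_add, pow_mul]; simp
    rw [this]
    field_simp
    ring
  -- For odd difference the new $G$ meets an old one, and $G^2=\alpha$ cancels the extra
  -- denominator.
  · rw [show (2 * e + 1 + 1 + 1) / 2 = e + 1 by omega, show (2 * e + 1 + 1) / 2 = e + 1 by omega,
      show (2 * e + 1 + 1) % 2 = 0 by omega, show (2 * e + 1) % 2 + 1 = 2 by omega, pow_two,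
      Cl.G_mul_G, ← Algebra.smul_def, smul_smul, pow_zero, one_mul]
    congr 1
    have : (-1 : k) ^ (r + (2 * e + 1)) = -(-1) ^ r := by
      rw [pow_add, pow_add, pow_mul]; simp
    rw [this]
    field_simp
    ring

variable (α) in
/-- The elements `X_i - γ_i / (2 α) G`, which anticommute with `G`. -/
def shiftedX (i : Fin n) : Cl α β γ lam :=
  Cl.X α β γ lam i - (γ i / (2 * α)) • Cl.G α β γ lam

/-- The shift is chosen so that the anticommutator
$\gamma_i-2\cdot\frac{\gamma_i}{2\alpha}\cdot\alpha$ vanishes. -/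
theorem shiftedX_mul_G (hk : (2 : k) ≠ 0) (hα : α ≠ 0) (i : Fin n) :
    shiftedX α β γ lam i * Cl.G α β γ lam = -(Cl.G α β γ lam * shiftedX α β γ lam i) := by
  rw [eq_neg_iff_add_eq_zero, shiftedX, sub_mul, mul_sub, smul_mul_assoc, mul_smul_comm, Cl.G_mul_G,
    sub_add_sub_comm, add_comm (Cl.X α β γ lam i * _), Cl.G_mul_X_add, ← two_smul k, smul_smul,
    Algebra.smul_def, ← map_mul, ← map_sub]
  have h : γ i - 2 * (γ i / (2 * α)) * α = 0 := by field_simp; ring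
  rw [h, map_zero]

theorem orderedProd_shiftedX_mul_G (hk : (2 : k) ≠ 0) (hα : α ≠ 0) (Q : Finset (Fin n)) :
    orderedProd (shiftedX α β γ lam) Q * Cl.G α β γ lam
      = (-1 : k) ^ Q.card • (Cl.G α β γ lam * orderedProd (shiftedX α β γ lam) Q) := by
  induction Q using Finset.induction_on_max with
  | empty => simp [orderedProd_empty]
  | insert m Q hm ih =>
    have hnot : m ∉ Q := fun h => lt_irrefl _ (hm m h)
    rw [orderedProd_insert_max _ hm, mul_assoc, shiftedX_mul_G _ _ _ hk hα, mul_neg, ← mul_assoc,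
      ih, Finset.card_insert_of_notMem hnot, pow_succ, smul_mul_assoc, mul_assoc, mul_neg_one,
      neg_smul]

/-- Multiplying by the factor for a largest $m$ and moving its $G$ to the left gives a two-term
recursion. Its terms match the subsets $R$ containing $m$ and those avoiding it. -/
theorem orderedProd_shiftedX (hk : (2 : k) ≠ 0) (hα : α ≠ 0) (Q : Finset (Fin n)) :
    orderedProd (shiftedX α β γ lam) Q = casimirValue α β γ lam Q := by
  induction Q using Finset.induction_on_max with
  | empty => simp [orderedProd_empty, casimirValue_eq_sum, casimirTerm, signExp]
  | insert m Q hm ih =>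
    have hnot : m ∉ Q := fun h => lt_irrefl _ (hm m h)
    have h1 : orderedProd (shiftedX α β γ lam) (insert m Q)
        = orderedProd (shiftedX α β γ lam) Q * Cl.X α β γ lam m
          + ((-1) ^ Q.card * -(γ m / (2 * α))) •
            (Cl.G α β γ lam * orderedProd (shiftedX α β γ lam) Q) := by
      rw [orderedProd_insert_max _ hm]
      conv_lhs => rw [shiftedX, mul_sub, mul_smul_comm, orderedProd_shiftedX_mul_G _ _ _ hk hα]
      module
    rw [h1, ih, casimirValue_eq_sum, casimirValue_eq_sum, Finset.sum_powerset_insert hnot,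
      Finset.sum_mul, Finset.mul_sum, Finset.smul_sum, add_comm]
    congr 1
    · exact Finset.sum_congr rfl fun R hR =>
        (casimirTerm_insert β γ lam hk hα (Finset.mem_powerset.mp hR) hm).symm
    · exact Finset.sum_congr rfl fun R hR =>
        (casimirTerm_insert_insert β γ lam (Finset.mem_powerset.mp hR) hm).symm

end Values

/-! ### Monomial bases. -/

section Basis

variable {k : Type*} [Field k] {n : ℕ}

namespace Cl

variable (α : k) (β γ : Fin n → k) (lam : Fin n → Fin n → k)

/-- The monomial `G^j X_P`. -/
def monomial (w : Fin 2 × Finset (Fin n)) : Cl α β γ lam :=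
  G α β γ lam ^ (w.1 : ℕ) * orderedProd (X α β γ lam) w.2

variable {α β γ lam}

theorem linearIndependent_monomial (hk : (2 : k) ≠ 0) (hα : α ≠ 0) :
    LinearIndependent k (monomial α β γ lam) := by
  rw [Fintype.linearIndependent_iff]
  intro c hc w
  have h := coeff_eq_zero_of_sum_eq_zero (β := β) (γ := γ) (lam := lam) hk hα Finset.univ
    (fun P => c (0, P)) (fun P => c (1, P)) (by
      rw [← hc, Fintype.sum_prod_type, Fin.sum_univ_two, Finset.powerset_univ,
        Finset.sum_add_distrib]
      simp [monomial]) w.2 (Finset.subset_univ _)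
  rcases w with ⟨j, P⟩
  fin_cases j
  · exact h.1
  · exact h.2

theorem partialSubalgebra_le_span (s : Finset (Fin n)) :
    ∀ a ∈ partialSubalgebra α β γ lam s,
      a ∈ Submodule.span k (monomial α β γ lam '' {w | w.2 ⊆ s}) := by
  induction s using Finset.induction_on_max with
  | empty =>
    intro a ha
    obtain ⟨u, v, rfl⟩ := exists_of_mem_partialSubalgebra_empty ha
    rw [Algebra.algebraMap_eq_smul_one]
    refine add_mem (Submodule.smul_mem _ _ (Submodule.subset_span ⟨(0, ∅), ?_, ?_⟩))
      (Submodule.smul_mem _ _ (Submodule.subset_span ⟨(1, ∅), ?_, ?_⟩)) <;>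
      simp [monomial, orderedProd_empty]
  | insert m s hm ih =>
    intro a ha
    obtain ⟨b, hb, c, hc, rfl⟩ := exists_eq_add_mul_X (fun h => lt_irrefl _ (hm m h)) ha
    refine add_mem (Submodule.span_mono ?_ (ih b hb)) ?_
    · exact Set.image_mono fun w (hw : w.2 ⊆ s) => hw.trans (Finset.subset_insert _ _)
    -- As $m$ exceeds all of $s$, right multiplication by $X_m$ sends monomials over $s$ to
    -- monomials.
    · have h1 := Submodule.mem_map_of_mem (f := LinearMap.mulRight k (X α β γ lam m)) (ih c hc)
      rw [Submodule.map_span] at h1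
      refine Submodule.span_mono ?_ h1
      rintro _ ⟨_, ⟨w, hw, rfl⟩, rfl⟩
      refine ⟨(w.1, insert m w.2), Finset.insert_subset_insert _ hw, ?_⟩
      simp [monomial, orderedProd_insert_max _ fun i hi => hm i (hw hi), mul_assoc]

theorem span_range_monomial : ⊤ ≤ Submodule.span k (Set.range (monomial α β γ lam)) := by
  intro a _
  refine Submodule.span_mono (Set.image_subset_range _ _)
    (partialSubalgebra_le_span Finset.univ a ?_)
  rw [partialSubalgebra_univ]
  trivial

end Cl

namespace E

variable (k n)

/-- `E(n)` is the algebra `Cl(1, 0, 0, 0)`. -/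
def equivCl : E k n ≃ₐ[k] Cl (1 : k) (0 : Fin n → k) 0 0 :=
  AlgEquiv.ofAlgHom
    (lift (Cl.G _ _ _ _) (Cl.X _ _ _ _)
      (by simp [Cl.G_mul_G]) (by simp [Cl.X_mul_X])
      (fun i => eq_neg_of_add_eq_zero_left (by simp [Cl.G_mul_X_add]))
      (fun i j hij => eq_neg_of_add_eq_zero_left (by simp [Cl.X_mul_X_add _ _ _ _ i j hij])))
    (Cl.lift (g k n) (x k) (by simp [g_mul_g]) (by simp [x_mul_x]) (by simp [g_mul_x])
      (fun i j hij => by simp [x_mul_x_of_lt k i j hij]))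
    (by
      apply Cl.algHom_ext
      · simp [Cl.lift_G, lift_g]
      · intro i
        simp [Cl.lift_X, lift_x])
    (by
      apply algHom_ext
      · simp [Cl.lift_G, lift_g]
      · intro i
        simp [Cl.lift_X, lift_x])

theorem equivCl_symm_monomial (w : Fin 2 × Finset (Fin n)) :
    (equivCl k n).symm (Cl.monomial _ _ _ _ w) = g k n ^ (w.1 : ℕ) * orderedProd (x k) w.2 := by
  have hG : (equivCl k n).symm (Cl.G _ _ _ _) = g k n := Cl.lift_G ..
  have hX : ∀ i, (equivCl k n).symm (Cl.X _ _ _ _ i) = x k i := fun i => Cl.lift_X ..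
  simp [Cl.monomial, map_orderedProd, hG, hX]

/-- The basis `g^j x_P` of `E(n)`. -/
def monomialBasis (hk : (2 : k) ≠ 0) : Module.Basis (Fin 2 × Finset (Fin n)) k (E k n) :=
  (Module.Basis.mk (Cl.linearIndependent_monomial hk one_ne_zero) Cl.span_range_monomial).map
    (equivCl k n).symm.toLinearEquiv

theorem monomialBasis_apply (hk : (2 : k) ≠ 0) (w : Fin 2 × Finset (Fin n)) :
    monomialBasis k n hk w = g k n ^ (w.1 : ℕ) * orderedProd (x k) w.2 := by
  simp [monomialBasis, equivCl_symm_monomial]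

end E

end Basis

variable {k : Type*} [Field k] {n : ℕ} {α : k} {β γ : Fin n → k} {lam : Fin n → Fin n → k}

/-! ### From balanced maps to algebra maps out of $E(n)$. -/

section General

variable {A : Type*} [Ring A] [Algebra k A]

/-- The map `h ⊗ h' ↦ f(S(h) h')`. -/
def antipodeTwist (f : E k n →ₗ[k] A) : E k n ⊗[k] E k n →ₗ[k] A :=
  f ∘ₗ LinearMap.mul' k (E k n) ∘ₗ (E.antipodeLinear k n).rTensor (E k n)

theorem antipodeTwist_tmul (f : E k n →ₗ[k] A) (h h' : E k n) :
    antipodeTwist f (h ⊗ₜ h') = f (E.antipodeLinear k n h * h') := by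
  simp [antipodeTwist]

theorem antipodeTwist_one_tmul (f : E k n →ₗ[k] A) (h : E k n) :
    antipodeTwist f (1 ⊗ₜ h) = f h := by
  rw [antipodeTwist_tmul, E.antipodeLinear_one, one_mul]

/-- This is $S(h_1)h_2=\varepsilon(h)$ inside $f(S(u)\,\cdot\,v)$. Allowing all tensors $t$ makes
the property multiplicative in $h$, so generators suffice. -/
theorem antipodeTwist_balanced (f : E k n →ₗ[k] A) (h : E k n) :
    ∀ t : E k n ⊗[k] E k n,
      antipodeTwist f (E.comulHom k n h * t) = E.counitHom k n h • antipodeTwist f t := by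
  induction h using E.induction with
  | hc c =>
    intro t
    rw [AlgHom.commutes, AlgHom.commutes, ← Algebra.smul_def, map_smul]
    rfl
  | hg =>
    intro t
    induction t using TensorProduct.induction_on with
    | zero => simp
    | add t₁ t₂ h₁ h₂ => simp only [mul_add, map_add, h₁, h₂, smul_add]
    | tmul u v =>
      rw [E.comulHom_g, E.counitHom_g, one_smul, Algebra.TensorProduct.tmul_mul_tmul,
        antipodeTwist_tmul, antipodeTwist_tmul, E.antipodeLinear_mul, E.antipodeLinear_g, mul_assoc,
        ← mul_assoc (E.g k n), E.g_mul_g, one_mul]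
  | hx i =>
    intro t
    induction t using TensorProduct.induction_on with
    | zero => simp
    | add t₁ t₂ h₁ h₂ => simp only [mul_add, map_add, h₁, h₂, smul_add]
    | tmul u v =>
      rw [E.comulHom_x, E.counitHom_x, zero_smul, add_mul, Algebra.TensorProduct.tmul_mul_tmul,
        Algebra.TensorProduct.tmul_mul_tmul, map_add, antipodeTwist_tmul, antipodeTwist_tmul,
        E.antipodeLinear_mul, E.antipodeLinear_x, one_mul, ← map_add, E.g_mul_x]
      have : E.antipodeLinear k n u * -(E.x k i * E.g k n) * (E.g k n * v)
          = -(E.antipodeLinear k n u * (E.x k i * (E.g k n * E.g k n) * v)) := by noncomm_ring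
      rw [this, E.g_mul_g, mul_one, neg_add_cancel, map_zero]
  | hmul a b ha hb =>
    intro t
    rw [map_mul (E.comulHom k n), map_mul (E.counitHom k n), mul_assoc, ha, hb, mul_smul]
  | hadd a b ha hb => intro t; rw [map_add, map_add, add_mul, map_add, ha, hb, add_smul]

/-- In Sweedler form, $hu\otimes v=h_1u\otimes h_2S(h_3)v$, and the balancing identity removes
$h_1,h_2$. On generators it is enough to balance against $u\otimes gv$, as $g^2=1$. -/
theorem apply_mul_tmul_of_balanced {B : E k n ⊗[k] E k n →ₗ[k] A}
    (hB : ∀ h h' h'' : E k n,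
      B (E.comulHom k n h * (h' ⊗ₜ h'')) = E.counitHom k n h • B (h' ⊗ₜ h''))
    (h : E k n) : ∀ u v : E k n, B ((h * u) ⊗ₜ v) = B (u ⊗ₜ (E.antipodeLinear k n h * v)) := by
  induction h using E.induction with
  | hc c =>
    intro u v
    rw [E.antipodeLinear_algebraMap, ← Algebra.smul_def, ← Algebra.smul_def,
      TensorProduct.smul_tmul]
  | hg =>
    intro u v
    have := hB (E.g k n) u (E.g k n * v)
    rw [E.antipodeLinear_g]
    rwa [E.comulHom_g, E.counitHom_g, one_smul, Algebra.TensorProduct.tmul_mul_tmul, ← mul_assoc,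
      E.g_mul_g, one_mul] at this
  | hx i =>
    intro u v
    have := hB (E.x k i) u (E.g k n * v)
    rw [E.comulHom_x, E.counitHom_x, zero_smul, add_mul, Algebra.TensorProduct.tmul_mul_tmul,
      Algebra.TensorProduct.tmul_mul_tmul, ← mul_assoc, E.g_mul_g, one_mul, one_mul, map_add,
      ← mul_assoc] at this
    rw [eq_neg_of_add_eq_zero_left this, E.antipodeLinear_x, E.g_mul_x, neg_mul,
      TensorProduct.tmul_neg, map_neg]
  | hmul a b ha hb =>
    intro u v
    rw [mul_assoc, ha, hb, E.antipodeLinear_mul, mul_assoc]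
  | hadd a b ha hb =>
    intro u v
    rw [add_mul, TensorProduct.add_tmul, map_add, ha, hb, map_add, add_mul, TensorProduct.tmul_add,
      map_add]

theorem IsRthCasimir.apply_tmul {ρ : RightComoduleAlgebra k (E k n) A}
    {B : E k n ⊗[k] E k n →ₗ[k] A} (hB : IsRthCasimir ρ B) (h h' : E k n) :
    B (h ⊗ₜ h') = B (1 ⊗ₜ (E.antipodeLinear k n h * h')) := by
  rw [← apply_mul_tmul_of_balanced hB.casimir_balanced, mul_one]

/-- Heaviness gives multiplicativity when the left factor lies in the image of $S$, and this image
contains the generators. -/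
theorem IsRthCasimir.mul_apply {ρ : RightComoduleAlgebra k (E k n) A}
    {B : E k n ⊗[k] E k n →ₗ[k] A} (hB : IsRthCasimir ρ B) (h : E k n) :
    ∀ h' : E k n, B (1 ⊗ₜ h) * B (1 ⊗ₜ h') = B (1 ⊗ₜ (h * h')) := by
  have key : ∀ h h' : E k n, B (1 ⊗ₜ E.antipodeLinear k n h) * B (1 ⊗ₜ h')
      = B (1 ⊗ₜ (E.antipodeLinear k n h * h')) := by
    intro h h'
    rw [← hB.apply_tmul h h', ← hB.heavy h h', hB.apply_tmul h 1, mul_one]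
  induction h using E.induction with
  | hc c => simpa [E.antipodeLinear_algebraMap] using key (algebraMap k _ c)
  | hg => simpa [E.antipodeLinear_g] using key (E.g k n)
  | hx i =>
    -- The preimage of $x_i$ under $S$ is $x_ig$, since $S(x_ig)=g\cdot gx_i$.
    have : E.antipodeLinear k n (E.x k i * E.g k n) = E.x k i := by
      rw [E.antipodeLinear_mul, E.antipodeLinear_g, E.antipodeLinear_x, ← mul_assoc, E.g_mul_g,
        one_mul]
    simpa [this] using key (E.x k i * E.g k n)
  | hmul a b ha hb =>
    intro h'
    rw [← ha, mul_assoc, hb, ha, mul_assoc]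
  | hadd a b ha hb =>
    intro h'
    rw [TensorProduct.tmul_add, map_add, add_mul, ha, hb, add_mul, TensorProduct.tmul_add, map_add]

/-- A Casimir element restricts to an algebra map `h ↦ B(1 ⊗ h)`. -/
def IsRthCasimir.toAlgHom {ρ : RightComoduleAlgebra k (E k n) A}
    {B : E k n ⊗[k] E k n →ₗ[k] A} (hB : IsRthCasimir ρ B) : E k n →ₐ[k] A :=
  AlgHom.ofLinearMap (B ∘ₗ TensorProduct.mk k _ _ 1) hB.normalized
    (fun h h' => (hB.mul_apply h h').symm)

end General

/-! ### Colinear algebra maps and Casimir elements. -/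

theorem isRthCasimir_antipodeTwist {μ : k} (hk : (2 : k) ≠ 0) (hα : α ≠ 0) (hμ : μ ^ 2 * α = 1)
    {f : E k n →ₐ[k] Cl α β γ lam} (hg : f (E.g k n) = μ • Cl.G α β γ lam)
    (hx : ∀ i, f (E.x k i) = shiftedX α β γ lam i) :
    IsRthCasimir (Cl.canonicalCoaction α β γ lam) (antipodeTwist f.toLinearMap) where
  casimir_bimodule := by
    let B := antipodeTwist f.toLinearMap
    have hB : ∀ h h', B (h ⊗ₜ h') = f (E.antipodeLinear k n h * h') :=
      antipodeTwist_tmul f.toLinearMap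
    -- With $L_t(u\otimes w)=uB(tw)$ and the algebra map $\Psi(a)=a_0\otimes a_1\otimes a_2$, the
    -- bimodule identity reads $L_t(\Psi(a))=B(t)a$. Stated for all $t$, it passes to products in
    -- $a$.
    let L (t : E k n ⊗[k] E k n) : Cl α β γ lam ⊗[k] (E k n ⊗[k] E k n) →ₗ[k] Cl α β γ lam :=
      LinearMap.mul' k _ ∘ₗ (B ∘ₗ LinearMap.mulLeft k t).lTensor _
    have hL : ∀ t u w, L t (u ⊗ₜ w) = u * B (t * w) := fun t u w => by simp [L]
    have hL_add : ∀ t t' s, L (t + t') s = L t s + L t' s := by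
      intro t t' s
      induction s using TensorProduct.induction_on with
      | zero => simp
      | add s s' hs hs' => rw [map_add, hs, hs', map_add, map_add]; abel
      | tmul u w => rw [hL, hL, hL, add_mul, map_add, mul_add]
    have hL_zero : ∀ s, L 0 s = 0 := by
      intro s
      have := hL_add 0 0 s
      rw [add_zero] at this
      exact left_eq_add.mp this
    let Ψ : Cl α β γ lam →ₐ[k] Cl α β γ lam ⊗[k] (E k n ⊗[k] E k n) :=
      (Algebra.TensorProduct.map (.id k _) (E.comulHom k n)).comp (Cl.coactHom α β γ lam)
    suffices key : ∀ a t, L t (Ψ a) = B t * a from fun a h h' => key a (h ⊗ₜ h')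
    intro a
    induction a using Cl.induction with
    | hc c =>
      intro t
      rw [AlgHom.commutes, Algebra.algebraMap_eq_smul_one, map_smul, Algebra.TensorProduct.one_def,
        hL, mul_one, one_mul, Algebra.algebraMap_eq_smul_one, mul_smul_comm, mul_one]
    | hG =>
      intro t
      induction t using TensorProduct.induction_on with
      | zero => rw [hL_zero, map_zero, zero_mul]
      | add t₁ t₂ h₁ h₂ => rw [hL_add, h₁, h₂, map_add, add_mul]
      | tmul h h' =>
        have hΨ : Ψ (Cl.G α β γ lam) = Cl.G α β γ lam ⊗ₜ (E.g k n ⊗ₜ E.g k n) := by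
          simp [Ψ, Cl.coactHom_G, E.comulHom_g]
        rw [hΨ, hL, Algebra.TensorProduct.tmul_mul_tmul, hB, hB, E.antipodeLinear_mul,
          E.antipodeLinear_g, map_mul, map_mul, map_mul, map_mul, hg]
        simp only [smul_mul_assoc, mul_smul_comm, smul_smul, ← mul_assoc, Cl.G_mul_G]
        rw [mul_assoc (algebraMap k _ α), mul_assoc (algebraMap k _ α), ← Algebra.smul_def,
          smul_smul, ← pow_two, hμ, one_smul]
    | hX i =>
      intro t
      induction t using TensorProduct.induction_on with
      | zero => rw [hL_zero, map_zero, zero_mul]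
      | add t₁ t₂ h₁ h₂ => rw [hL_add, h₁, h₂, map_add, add_mul]
      | tmul h h' =>
        have hΨ : Ψ (Cl.X α β γ lam i) = Cl.X α β γ lam i ⊗ₜ (E.g k n ⊗ₜ E.g k n)
            + 1 ⊗ₜ (E.x k i ⊗ₜ E.g k n) + 1 ⊗ₜ (1 ⊗ₜ E.x k i) := by
          simp [Ψ, Cl.coactHom_X, E.comulHom_g, E.comulHom_x, TensorProduct.tmul_add,
            add_assoc]
        rw [hΨ, map_add, map_add, hL, hL, hL]
        simp only [Algebra.TensorProduct.tmul_mul_tmul, hB, E.antipodeLinear_mul,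
          E.antipodeLinear_g, E.antipodeLinear_x, mul_one, one_mul, map_mul, hg, hx]
        generalize f (E.antipodeLinear k n h) = p
        generalize f h' = q
        -- The terms of $\Psi(X_i)$ ending in $g$ combine through this scalar; as
        -- $\mu^2\gamma_i/2=\gamma_i/(2\alpha)$, they cancel the shift in the third term.
        have hXG : Cl.X α β γ lam i * Cl.G α β γ lam + Cl.G α β γ lam * shiftedX α β γ lam i
            = algebraMap k _ (γ i / 2) := by
          rw [shiftedX, mul_sub, mul_smul_comm, Cl.G_mul_G, ← add_sub_assoc,
            add_comm (Cl.X α β γ lam i * _), Cl.G_mul_X_add, Algebra.smul_def, ← map_mul, ← map_sub]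
          congr 1
          field_simp
          ring
        have h1 : Cl.X α β γ lam i * (μ • Cl.G α β γ lam * p * (q * μ • Cl.G α β γ lam))
            + μ • Cl.G α β γ lam * shiftedX α β γ lam i * p * (q * μ • Cl.G α β γ lam)
            = μ ^ 2 • ((Cl.X α β γ lam i * Cl.G α β γ lam
              + Cl.G α β γ lam * shiftedX α β γ lam i) * (p * q * Cl.G α β γ lam)) := by
          simp only [smul_mul_assoc, mul_smul_comm, smul_smul, ← pow_two, add_mul, smul_add,
            mul_assoc]
        have h2 : μ ^ 2 * (γ i / 2) = γ i / (2 * α) := by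
          rw [eq_div_iff (mul_ne_zero hk hα)]
          have h3 : γ i / 2 * 2 = γ i := div_mul_cancel₀ _ hk
          linear_combination γ i * hμ + μ ^ 2 * α * h3
        rw [h1, hXG, ← Algebra.smul_def, smul_smul, h2, shiftedX, mul_sub, mul_sub, mul_smul_comm,
          mul_smul_comm, ← mul_assoc, ← mul_assoc, add_sub_cancel]
    | hmul a b ha hb =>
      have hLb : ∀ t s, L t (s * Ψ b) = L t s * b := by
        intro t s
        induction s using TensorProduct.induction_on with
        | zero => simp
        | add s s' hs hs' => rw [add_mul, map_add, hs, hs', map_add, add_mul]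
        | tmul u w =>
          have : ∀ r, L t ((u ⊗ₜ w) * r) = u * L (t * w) r := by
            intro r
            induction r using TensorProduct.induction_on with
            | zero => simp
            | add r r' hr hr' => rw [mul_add, map_add, hr, hr', map_add, mul_add]
            | tmul u' w' =>
              rw [Algebra.TensorProduct.tmul_mul_tmul, hL, hL, mul_assoc, mul_assoc]
          rw [this, hb, hL, mul_assoc]
      intro t
      rw [map_mul, hLb, ha, mul_assoc]
    | hadd a b ha hb => intro t; rw [map_add, map_add, ha, hb, mul_add]
  casimir_colinear h := by
    have h1 : (Cl.coactHom α β γ lam).comp f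
        = (Algebra.TensorProduct.map f (.id k _)).comp (E.comulHom k n) := by
      apply E.algHom_ext
      · simp [hg, Cl.coactHom_G, E.comulHom_g, TensorProduct.smul_tmul']
      · intro i
        simp [hx, shiftedX, Cl.coactHom_G, Cl.coactHom_X, E.comulHom_x, TensorProduct.sub_tmul,
          TensorProduct.smul_tmul']
        abel
    have h2 : antipodeTwist f.toLinearMap ∘ₗ TensorProduct.mk k _ _ 1 = f.toLinearMap :=
      LinearMap.ext fun h => antipodeTwist_one_tmul f.toLinearMap h
    rw [h2, antipodeTwist_one_tmul]
    exact DFunLike.congr_fun h1 h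
  casimir_balanced h h' h'' := antipodeTwist_balanced _ h _
  normalized := by rw [antipodeTwist_one_tmul]; exact map_one f
  heavy h h' := by
    rw [antipodeTwist_one_tmul, antipodeTwist_tmul, antipodeTwist_tmul, mul_one]
    exact (map_mul f _ _).symm

theorem IsRthCasimir.coact_apply {B : E k n ⊗[k] E k n →ₗ[k] Cl α β γ lam}
    (hB : IsRthCasimir (Cl.canonicalCoaction α β γ lam) B) (h : E k n) :
    Cl.coactHom α β γ lam (hB.toAlgHom h)
      = hB.toAlgHom.toLinearMap.rTensor (E k n) (E.comulHom k n h) :=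
  hB.casimir_colinear h

theorem IsRthCasimir.exists_parameter (hk : (2 : k) ≠ 0)
    {B : E k n ⊗[k] E k n →ₗ[k] Cl α β γ lam}
    (hB : IsRthCasimir (Cl.canonicalCoaction α β γ lam) B) :
    (α ≠ 0 ∧ (∀ i, β i = γ i ^ 2 / (4 * α)) ∧ ∀ i j, i < j → lam i j = γ i * γ j / (2 * α)) ∧
      ∃ μ : k, μ ^ 2 * α = 1 ∧ hB.toAlgHom (E.g k n) = μ • Cl.G α β γ lam ∧
        ∀ i, hB.toAlgHom (E.x k i) = shiftedX α β γ lam i := by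
  have hinj := Cl.algebraMap_injective (α := α) (β := β) (γ := γ) (lam := lam) hk
  obtain ⟨μ, hg⟩ : ∃ μ : k, hB.toAlgHom (E.g k n) = μ • Cl.G α β γ lam := by
    refine Cl.exists_eq_smul_G_of_coact hk ?_
    rw [hB.coact_apply, E.comulHom_g]
    rfl
  -- The summand $1\otimes x_i$ occurs in both coactions and cancels in the difference.
  have hd : ∀ i, ∃ d : k, hB.toAlgHom (E.x k i) - Cl.X α β γ lam i = d • Cl.G α β γ lam := by
    intro i
    refine Cl.exists_eq_smul_G_of_coact hk ?_
    rw [map_sub, hB.coact_apply, E.comulHom_x, Cl.coactHom_X, map_add, LinearMap.rTensor_tmul,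
      LinearMap.rTensor_tmul, AlgHom.toLinearMap_apply, AlgHom.toLinearMap_apply, map_one,
      TensorProduct.sub_tmul]
    abel
  choose d hd using hd
  have hx : ∀ i, hB.toAlgHom (E.x k i) = Cl.X α β γ lam i + d i • Cl.G α β γ lam :=
    fun i => by rw [← hd i]; abel
  have hμ : μ ^ 2 * α = 1 := by
    apply hinj
    rw [map_mul, ← Cl.G_mul_G α β γ lam, ← Algebra.smul_def, map_one,
      ← map_one hB.toAlgHom, ← E.g_mul_g, map_mul, hg, smul_mul_smul_comm, pow_two]
  have hα : α ≠ 0 := by rintro rfl; simp at hμ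
  have hμ0 : μ ≠ 0 := by rintro rfl; simp at hμ
  -- From $gx_i=-x_ig$, after dividing by $\mu\ne0$.
  have hdi : ∀ i, γ i + 2 * d i * α = 0 := by
    intro i
    have h1 := congrArg hB.toAlgHom (E.g_mul_x k i)
    rw [map_neg, map_mul, map_mul, hg, hx, eq_neg_iff_add_eq_zero, smul_mul_assoc, mul_smul_comm,
      ← smul_add, smul_eq_zero_iff_right hμ0, mul_add, add_mul, mul_smul_comm, smul_mul_assoc,
      Cl.G_mul_G, add_add_add_comm, Cl.G_mul_X_add, ← two_smul k, smul_smul, Algebra.smul_def,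
      ← map_mul, ← map_add] at h1
    exact hinj (h1.trans (map_zero _).symm)
  have hprod : ∀ i j, (Cl.X α β γ lam i + d i • Cl.G α β γ lam)
      * (Cl.X α β γ lam j + d j • Cl.G α β γ lam)
      = Cl.X α β γ lam i * Cl.X α β γ lam j + d j • (Cl.X α β γ lam i * Cl.G α β γ lam)
        + d i • (Cl.G α β γ lam * Cl.X α β γ lam j) + (d i * d j) • algebraMap k _ α := by
    intro i j
    rw [← Cl.G_mul_G α β γ lam]
    simp only [add_mul, mul_add, smul_mul_assoc, mul_smul_comm]
    module
  have hdval : ∀ i, d i = -(γ i / (2 * α)) := by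
    intro i
    rw [← neg_div, eq_div_iff (mul_ne_zero hk hα)]
    linear_combination hdi i
  have h4 : (4 : k) ≠ 0 := by
    have : (4 : k) = 2 * 2 := by norm_num
    rw [this]
    exact mul_ne_zero hk hk
  refine ⟨⟨hα, fun i => ?_, fun i j hij => ?_⟩, μ, hμ, hg, fun i => ?_⟩
  · have h1 := congrArg hB.toAlgHom (E.x_mul_x k i)
    rw [map_mul, hx, map_zero, hprod, Cl.X_mul_X, add_assoc (algebraMap k _ _), ← smul_add,
      add_comm (Cl.X α β γ lam i * _), Cl.G_mul_X_add, Algebra.smul_def, Algebra.smul_def,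
      ← map_mul, ← map_mul, ← map_add, ← map_add] at h1
    have h2 := hinj (h1.trans (map_zero _).symm)
    rw [hdval] at h2
    rw [eq_div_iff (mul_ne_zero h4 hα)]
    field_simp at h2
    linear_combination h2
  · have h1 := congrArg hB.toAlgHom (E.x_mul_x_of_lt k i j hij)
    rw [map_neg, map_mul, map_mul, hx, hx, eq_neg_iff_add_eq_zero, hprod, hprod] at h1
    have h3 : algebraMap k (Cl α β γ lam) (lam i j + d j * γ i + d i * γ j + 2 * (d i * d j) * α)
        = 0 := by
      rw [← h1, map_add, map_add, map_add, map_mul, map_mul, map_mul,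
        ← Cl.X_mul_X_add α β γ lam i j hij, ← Cl.G_mul_X_add α β γ lam i,
        ← Cl.G_mul_X_add α β γ lam j]
      simp only [← Algebra.smul_def]
      module
    have h2 := hinj (h3.trans (map_zero _).symm)
    rw [hdval, hdval] at h2
    rw [eq_div_iff (mul_ne_zero hk hα)]
    field_simp at h2
    linear_combination h2
  · rw [hx, hdval, neg_smul, shiftedX, sub_eq_add_neg]

/-- The shifted generators have squares $\beta_i-\gamma_i^2/(4\alpha)$ and anticommutators
$\lambda_{ij}-\gamma_i\gamma_j/(2\alpha)$, zero by hypothesis. -/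
theorem exists_algHom {μ : k} (hk : (2 : k) ≠ 0) (hα : α ≠ 0) (hμ : μ ^ 2 * α = 1)
    (hβ : ∀ i, β i = γ i ^ 2 / (4 * α)) (hlam : ∀ i j, i < j → lam i j = γ i * γ j / (2 * α)) :
    ∃ f : E k n →ₐ[k] Cl α β γ lam, f (E.g k n) = μ • Cl.G α β γ lam ∧
      ∀ i, f (E.x k i) = shiftedX α β γ lam i := by
  have hprod : ∀ i j, shiftedX α β γ lam i * shiftedX α β γ lam j
      = Cl.X α β γ lam i * Cl.X α β γ lam j
        - (γ j / (2 * α)) • (Cl.X α β γ lam i * Cl.G α β γ lam)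
        - (γ i / (2 * α)) • (Cl.G α β γ lam * Cl.X α β γ lam j)
        + (γ i / (2 * α) * (γ j / (2 * α))) • algebraMap k _ α := by
    intro i j
    rw [← Cl.G_mul_G α β γ lam]
    simp only [shiftedX, sub_mul, mul_sub, smul_mul_assoc, mul_smul_comm]
    module
  refine ⟨E.lift (μ • Cl.G α β γ lam) (shiftedX α β γ lam) ?_ ?_ ?_ ?_, E.lift_g .., fun _ => E.lift_x ..⟩
  · rw [smul_mul_smul_comm, Cl.G_mul_G, Algebra.smul_def, ← map_mul, ← pow_two, hμ, map_one]
  · intro i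
    have h1 : shiftedX α β γ lam i * shiftedX α β γ lam i
        = algebraMap k _ (β i - γ i / (2 * α) * γ i + γ i / (2 * α) * (γ i / (2 * α)) * α) := by
      rw [hprod, map_add, map_sub, map_mul _ _ (γ i), map_mul _ _ α, ← Cl.G_mul_X_add α β γ lam i,
        ← Cl.X_mul_X α β γ lam i]
      simp only [← Algebra.smul_def]
      module
    have h2 : β i - γ i / (2 * α) * γ i + γ i / (2 * α) * (γ i / (2 * α)) * α = 0 := by
      rw [hβ i, show (4 : k) = 2 * 2 by norm_num]
      field_simp
      ring
    rw [h1, h2, map_zero]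
  · intro i
    rw [smul_mul_assoc, mul_smul_comm, shiftedX_mul_G _ _ _ hk hα, smul_neg, neg_neg]
  · intro i j hij
    have h1 : shiftedX α β γ lam i * shiftedX α β γ lam j
        + shiftedX α β γ lam j * shiftedX α β γ lam i
        = algebraMap k _ (lam i j - γ j / (2 * α) * γ i - γ i / (2 * α) * γ j
          + 2 * (γ i / (2 * α) * (γ j / (2 * α))) * α) := by
      rw [hprod, hprod, map_add, map_sub, map_sub, map_mul _ _ (γ i), map_mul _ _ (γ j),
        map_mul _ _ α, ← Cl.X_mul_X_add α β γ lam i j hij, ← Cl.G_mul_X_add α β γ lam i,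
        ← Cl.G_mul_X_add α β γ lam j]
      simp only [← Algebra.smul_def]
      module
    have h2 : lam i j - γ j / (2 * α) * γ i - γ i / (2 * α) * γ j
          + 2 * (γ i / (2 * α) * (γ j / (2 * α))) * α = 0 := by
      rw [hlam i j hij]
      field_simp
      ring
    rw [eq_neg_iff_add_eq_zero, h1, h2, map_zero]

/-! ### The explicit formulas and the classification. -/

theorem isExplicitCasimir_of_algHom {μ : k} (hk : (2 : k) ≠ 0) (hα : α ≠ 0)
    {B : E k n ⊗[k] E k n →ₗ[k] Cl α β γ lam} {f : E k n →ₐ[k] Cl α β γ lam}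
    (hB : ∀ h h', B (h ⊗ₜ h') = f (E.antipodeLinear k n h * h'))
    (hg : f (E.g k n) = μ • Cl.G α β γ lam) (hx : ∀ i, f (E.x k i) = shiftedX α β γ lam i) :
    IsExplicitCasimir μ B := by
  have h1 : ∀ h, B (1 ⊗ₜ h) = f h := fun h => by rw [hB, E.antipodeLinear_one, one_mul]
  refine ⟨fun j l P Q => ?_, fun Q => ?_, fun Q => ?_⟩
  · rw [h1, hB]
    rfl
  · rw [h1, map_orderedProd, ← orderedProd_shiftedX β γ lam hk hα]
    simp only [hx]
  · rw [h1, h1, map_mul, hg]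

theorem IsExplicitCasimir.ext (hk : (2 : k) ≠ 0) {μ : k}
    {B B' : E k n ⊗[k] E k n →ₗ[k] Cl α β γ lam} (hB : IsExplicitCasimir μ B)
    (hB' : IsExplicitCasimir μ B') : B = B' := by
  have h1 : B ∘ₗ TensorProduct.mk k _ _ 1 = B' ∘ₗ TensorProduct.mk k _ _ 1 := by
    refine (E.monomialBasis k n hk).ext fun ⟨j, P⟩ => ?_
    rw [E.monomialBasis_apply]
    fin_cases j
    · simp [hB.value_x, hB'.value_x]
    · simp [hB.value_x, hB'.value_x, hB.value_gx, hB'.value_gx]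
  refine ((E.monomialBasis k n hk).tensorProduct (E.monomialBasis k n hk)).ext
    fun ⟨⟨j, P⟩, l, Q⟩ => ?_
  rw [Module.Basis.tensorProduct_apply, E.monomialBasis_apply, E.monomialBasis_apply]
  simp only [hB.reduce, hB'.reduce]
  exact DFunLike.congr_fun h1 _

/-- The values on the basis $g^jx_Q$ may be prescribed freely and `antipodeTwist` supplies the
reduction formula; multiplicativity plays no role, so the scalars need no condition. -/
theorem exists_isExplicitCasimir (hk : (2 : k) ≠ 0) (μ : k) :
    ∃ B : E k n ⊗[k] E k n →ₗ[k] Cl α β γ lam, IsExplicitCasimir μ B := by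
  let f : E k n →ₗ[k] Cl α β γ lam := (E.monomialBasis k n hk).constr k
    fun w => (μ • Cl.G α β γ lam) ^ (w.1 : ℕ) * casimirValue α β γ lam w.2
  have hf : ∀ w : Fin 2 × Finset (Fin n), f (E.g k n ^ (w.1 : ℕ) * orderedProd (E.x k) w.2)
      = (μ • Cl.G α β γ lam) ^ (w.1 : ℕ) * casimirValue α β γ lam w.2 := by
    intro w
    rw [← E.monomialBasis_apply k n hk, Module.Basis.constr_basis]
  have hf0 : ∀ Q, f (orderedProd (E.x k) Q) = casimirValue α β γ lam Q := fun Q => by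
    simpa using hf (0, Q)
  refine ⟨antipodeTwist f, fun j l P Q => ?_, fun Q => ?_, fun Q => ?_⟩
  · rw [antipodeTwist_one_tmul, antipodeTwist_tmul]
    rfl
  · rw [antipodeTwist_one_tmul, hf0]
  · rw [antipodeTwist_one_tmul, antipodeTwist_one_tmul, hf0]
    simpa using hf (1, Q)

theorem isRthCasimir_iff (hk : (2 : k) ≠ 0) (B : E k n ⊗[k] E k n →ₗ[k] Cl α β γ lam) :
    IsRthCasimir (Cl.canonicalCoaction α β γ lam) B ↔
      (α ≠ 0 ∧ (∀ i, β i = γ i ^ 2 / (4 * α)) ∧ ∀ i j, i < j → lam i j = γ i * γ j / (2 * α)) ∧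
        ∃ μ : k, μ ^ 2 * α = 1 ∧ IsExplicitCasimir μ B := by
  constructor
  · intro hB
    obtain ⟨h, μ, hμ, hg, hx⟩ := hB.exists_parameter hk
    exact ⟨h, μ, hμ, isExplicitCasimir_of_algHom hk h.1 (fun u v => hB.apply_tmul u v) hg hx⟩
  · rintro ⟨⟨hα, hβ, hlam⟩, μ, hμ, hB⟩
    obtain ⟨f, hg, hx⟩ := exists_algHom hk hα hμ hβ hlam
    -- The formulas determine $B$, so it is the twist of the algebra map $f$.
    rw [hB.ext hk (isExplicitCasimir_of_algHom hk hα
      (antipodeTwist_tmul f.toLinearMap) hg hx)]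
    exact isRthCasimir_antipodeTwist hk hα hμ hg hx

end

end CliffordCowreath

theorem theorem4 {k : Type*} [Field k] (hk : (2 : k) ≠ 0) (n : ℕ)
    (α : k) (β γ : Fin n → k) (lam : Fin n → Fin n → k) :
    -- the criterion
    (CliffordCowreath.RthSeparable (CliffordCowreath.Cl.canonicalCoaction α β γ lam) ↔
      (α ≠ 0 ∧ ∃ μ : k, μ ^ 2 * α = 1) ∧ (∀ i, β i = γ i ^ 2 / (4 * α)) ∧
        ∀ i j, i < j → lam i j = γ i * γ j / (2 * α)) ∧
    -- the Casimir elements are exactly the explicit ones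
    (∀ B : CliffordCowreath.E k n ⊗[k] CliffordCowreath.E k n →ₗ[k]
          CliffordCowreath.Cl α β γ lam,
      CliffordCowreath.IsRthCasimir (CliffordCowreath.Cl.canonicalCoaction α β γ lam) B ↔
        ((α ≠ 0 ∧ (∀ i, β i = γ i ^ 2 / (4 * α)) ∧
            ∀ i j, i < j → lam i j = γ i * γ j / (2 * α)) ∧
          ∃ μ : k, μ ^ 2 * α = 1 ∧ CliffordCowreath.IsExplicitCasimir μ B)) ∧
    -- for every admissible `μ` the formulas define exactly one linear map
    (∀ μ : k, μ ^ 2 * α = 1 →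
      ∃! B : CliffordCowreath.E k n ⊗[k] CliffordCowreath.E k n →ₗ[k]
          CliffordCowreath.Cl α β γ lam,
        CliffordCowreath.IsExplicitCasimir μ B) := by
  refine ⟨⟨?_, ?_⟩, CliffordCowreath.isRthCasimir_iff hk, fun μ _ => ?_⟩
  · rintro ⟨B, hB⟩
    obtain ⟨⟨hα, hβ, hlam⟩, μ, hμ, -⟩ := (CliffordCowreath.isRthCasimir_iff hk B).mp hB
    exact ⟨⟨hα, μ, hμ⟩, hβ, hlam⟩
  · rintro ⟨⟨hα, μ, hμ⟩, hβ, hlam⟩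
    obtain ⟨B, hB⟩ := CliffordCowreath.exists_isExplicitCasimir (α := α) (β := β) (γ := γ)
      (lam := lam) hk μ
    exact ⟨B, (CliffordCowreath.isRthCasimir_iff hk B).mpr ⟨⟨hα, hβ, hlam⟩, μ, hμ, hB⟩⟩
  · obtain ⟨B, hB⟩ := CliffordCowreath.exists_isExplicitCasimir (α := α) (β := β) (γ := γ)
      (lam := lam) hk μ
    exact ⟨B, hB, fun B' hB' => hB'.ext hk hB⟩
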